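/- Let $N\in\mathbb N$, let $k\in\frac12\mathbb Z$ (with $4\mid N$ if $k\notin\mathbb Z$), and let $\chi$ be a Dirichlet character modulo $N$. For $k\in\mathbb Z$ and $\gamma=\left(\begin{smallmatrix}a&b\\c&d\end{smallmatrix}\right)\in \mathrm{SL}_2(\mathbb Z)$ put $(f|_k\gamma)(z)=(cz+d)^{-k}f(\gamma z)$; for $k\in\frac12+\mathbb Z$ and $\gamma\in\Gamma_0(4)$ put $(f|_k\gamma)(z)=\left(\frac cd\right)\varepsilon_d^{2k}(cz+d)^{-k}f(\gamma z)$, where $\left(\frac cd\right)$ is the Kronecker symbol, $\varepsilon_d=1$ or $i$ according as $d\equiv1$ or $3\pmod 4$, and powers are principal. A harmonic Maass form $f\in H_k(N,\chi)$ is a smooth function $f:\mathbb H\to\mathbb C$ on the upper half-plane such that $f|_k\gamma=\chi(d)f$ for all $\gamma\in\Gamma_0(N)$; $\Delta_kf=0$, where $\Delta_k=-y^2(\partial_x^2+\partial_y^2)+iky(\partial_x+i\partial_y)$; and for each $\sigma=\left(\begin{smallmatrix}a&b\\c&d\end{smallmatrix}\right)\in\mathrm{SL}_2(\mathbb Z)$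 there are an integer $M\ge1$, a polynomial $P$ and $\varepsilon>0$ such that $(cz+d)^{-k}f(\sigma z)-P(e^{-2\pi iz/M})=O(e^{-\varepsilon y})$ as $y=\operatorname{Im} z\to\infty$. The form $f$ is weakly holomorphic if it is moreover holomorphic on $\mathbb H$, i.e. if its expansions have no non-holomorphic part. Let $f\in H_k(N,\chi)$ and $g(z)=(f|_kw_N)(z)=N^{k/2}(Nz)^{-k}f(-1/(Nz))$. Let $n_0\ge 0$ be an integer such that $f$ and $g$ have the Fourier expansions (with $q=e^{2\pi iz}$) $$f(z)=\sum_{n\ge-n_0}c^+(n)q^n+\sum_{n\ge1}c^-(n)\Gamma(1-k,4\pi ny)q^{-n},\qquad g(z)=\sum_{n\ge-n_0}d^+(n)q^n+\sum_{n\ge1}d^-(n)\Gamma(1-k,4\pi ny)q^{-n},$$ where $\Gamma(s,x)=\int_x^\infty t^{s-1}e^{-t}\,dt$. Suppose that $c^+(n),d^+(n)=O(e^{C_f\sqrt n})$ as $n\to\infty$, let $C>\max\left(C_f^2\sqrt N/(8\pi),\,2\pi n_0/\sqrt N\right)$, and set $D_n=C+2\pi n/\sqrt N$. Let $K_\nu$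 denote the modified Bessel function of the second kind. (i) If $k$ is a non-positive integer, then for every $X>0$ all the infinite series below converge absolutely and $$\sum_{n\ge-n_0}c^+(n)K_0\left(2\sqrt{D_n(C+\sqrt NX)}\right)+\sum_{\ell=0}^{|k|}\frac{|k|!}{\ell!}\left(\frac{4\pi\sqrt C}{\sqrt N}\sqrt{1+\frac{\sqrt NX}{C}}\right)^{\ell}\sum_{n>0}c^-(n)\left(\frac n{\sqrt{D_n}}\right)^{\ell}K_\ell\left(2\sqrt{D_n(C+\sqrt NX)}\right)$$ $$=i^kC^{\frac k2}\sum_{n\ge-n_0}d^+(n)\left(\sqrt NX+D_n\right)^{-\frac k2}K_k\left(2\sqrt{C(D_n+\sqrt NX)}\right)$$ $$\quad+i^kC^{\frac k2}\sum_{\ell=0}^{|k|}\frac{|k|!}{\ell!}\left(\frac{4\pi\sqrt C}{\sqrt N}\right)^{\ell}\sum_{n>0}d^-(n)\,n^\ell\left(D_n+\sqrt NX\right)^{-\frac{\ell+k}2}K_{\ell+k}\left(2\sqrt{C(D_n+\sqrt NX)}\right).$$ (ii) If $f$ is weakly holomorphic, so that $c^-=d^-=0$, then for every $k\in\frac12\mathbb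 Z$ and every $X>0$ the identity holds without the terms in $c^-$ and $d^-$: both series below converge absolutely and $$\sum_{n\ge-n_0}c^+(n)K_0\left(2\sqrt{D_n(C+\sqrt NX)}\right)=i^kC^{\frac k2}\sum_{n\ge-n_0}d^+(n)\left(\sqrt NX+D_n\right)^{-\frac k2}K_k\left(2\sqrt{C(D_n+\sqrt NX)}\right),$$ with $i^k=e^{\pi ik/2}$. -/

import Mathlib

open UpperHalfPlane Filter Asymptotics
open scoped MatrixGroups ContDiff

noncomputable section

/-- The modified Bessel function of the second kind `K_ν(x)`, for real order `ν` and `x > 0`,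
`K_ν(x) = ∫_0^∞ e^{-x cosh t} cosh (ν t) dt`. -/
def besselK (ν x : ℝ) : ℝ :=
  ∫ t in Set.Ioi (0 : ℝ), Real.exp (-x * Real.cosh t) * Real.cosh (ν * t)

/-- The upper incomplete Gamma function `Γ(s, x) = ∫_x^∞ t^{s-1} e^{-t} dt`, for `x > 0`. -/
def upperGamma (s x : ℝ) : ℝ :=
  ∫ t in Set.Ioi x, t ^ (s - 1) * Real.exp (-t)

/-- The Kronecker symbol `(c / d)` for odd `d` (of either sign). -/
def kroneckerOdd (c d : ℤ) : ℤ :=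
  (if c < 0 ∧ d < 0 then -1 else 1) * jacobiSym c d.natAbs

/-- `ε_d` for odd `d`: it is `1` if `d ≡ 1 (mod 4)` and `i` if `d ≡ 3 (mod 4)`. -/
def epsOdd (d : ℤ) : ℂ := if d % 4 = 1 then 1 else Complex.I

/-- `(c z + d)^{-k} f(γ z)`, with the principal branch of the power. -/
def slashPlain (k : ℝ) (f : ℍ → ℂ) (γ : SL(2, ℤ)) (z : ℍ) : ℂ :=
  (((γ 1 0 : ℤ) : ℂ) * (z : ℂ) + ((γ 1 1 : ℤ) : ℂ)) ^ (-(k : ℂ)) * f (γ • z)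

open Classical in
/-- The Petersson slash operator `f|_k γ` of weight `k ∈ ½ℤ`; if `k` is not an integer it is meant
for `γ ∈ Γ₀(4)`, and then has the additional factor `(c / d) ε_d^{2k}`. -/
def slashHalf (k : ℝ) (f : ℍ → ℂ) (γ : SL(2, ℤ)) (z : ℍ) : ℂ :=
  (if ∃ j : ℤ, k = j then 1
    else (kroneckerOdd (γ 1 0) (γ 1 1) : ℂ) * epsOdd (γ 1 1) ^ (2 * (k : ℂ)))
    * slashPlain k f γ z

lemma fricke_im_pos (N : ℕ) [NeZero N] (z : ℍ) : 0 < (-1 / ((N : ℂ) * (z : ℂ))).im := by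
  have hN : (0 : ℝ) < N := Nat.cast_pos.mpr (Nat.pos_of_ne_zero (NeZero.ne N))
  have h : (0 : ℝ) < ((N : ℂ) * (z : ℂ)).im := by
    simpa using mul_pos hN z.im_pos
  have h0 : (N : ℂ) * (z : ℂ) ≠ 0 := fun e => by simp [e] at h
  rw [neg_div, one_div, Complex.neg_im, Complex.inv_im, neg_div, neg_neg]
  exact div_pos h (Complex.normSq_pos.mpr h0)

/-- The action of the Fricke involution,
`(f|_k w_N)(z) = N^{k/2} (N z)^{-k} f(-1/(N z))`, with the principal branch of the power. -/
def frickeSlash (k : ℝ) (N : ℕ) [NeZero N] (f : ℍ → ℂ) (z : ℍ) : ℂ :=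
  (((N : ℝ) ^ (k / 2) : ℝ) : ℂ) * ((N : ℂ) * (z : ℂ)) ^ (-(k : ℂ)) *
    f ⟨-1 / ((N : ℂ) * (z : ℂ)), fricke_im_pos N z⟩

/-- The partial derivative `∂F/∂x` of a function of `z = x + i y`. -/
def partialX (F : ℂ → ℂ) (z : ℂ) : ℂ := fderiv ℝ F z 1

/-- The partial derivative `∂F/∂y` of a function of `z = x + i y`. -/
def partialY (F : ℂ → ℂ) (z : ℂ) : ℂ := fderiv ℝ F z Complex.I

/-- The weight `k` hyperbolic Laplacian
`Δ_k = -y² (∂²/∂x² + ∂²/∂y²) + i k y (∂/∂x + i ∂/∂y)`. -/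
def hypLaplacian (k : ℝ) (F : ℂ → ℂ) (z : ℂ) : ℂ :=
  -(z.im : ℂ) ^ 2 * (partialX (partialX F) z + partialY (partialY F) z)
    + Complex.I * (k : ℂ) * (z.im : ℂ) * (partialX F z + Complex.I * partialY F z)

/-- `f` is a harmonic Maass form of weight `k` and character `χ` on `Γ₀(N)`: it is smooth,
`f|_k γ = χ(γ) f` on `Γ₀(N)`, `Δ_k f = 0`, and at each cusp it is, up to an exponentially decaying
error, a polynomial in `q^{-1/M}`, where `q^{1/M} = e^{2πiz/M}` is a local parameter at the cusp. -/
structure IsHarmonicMaassForm (k : ℝ) (N : ℕ) (χ : DirichletCharacter ℂ N) (f : ℍ → ℂ) :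
    Prop where
  smooth : ContDiffOn ℝ ∞ (f ∘ ofComplex) {z : ℂ | 0 < z.im}
  slash_eq : ∀ γ ∈ CongruenceSubgroup.Gamma0 N, ∀ z : ℍ,
    slashHalf k f γ z = χ ((γ 1 1 : ℤ) : ZMod N) * f z
  laplacian_eq_zero : ∀ z : ℍ, hypLaplacian k (f ∘ ofComplex) (z : ℂ) = 0
  cusps : ∀ σ : SL(2, ℤ), ∃ (M : ℕ) (P : Polynomial ℂ) (ε : ℝ), 0 < M ∧ 0 < ε ∧
    (fun z : ℍ => slashPlain k f σ z
      - P.eval (Complex.exp (-(2 * Real.pi * Complex.I * (z : ℂ) / (M : ℂ)))))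
      =O[atImInfty] (fun z : ℍ => Real.exp (-ε * z.im))

/-- `f` is a weakly holomorphic modular form: a harmonic Maass form that is holomorphic, i.e.
whose expansions have no non-holomorphic part. -/
structure IsWeaklyHolomorphicForm (k : ℝ) (N : ℕ) (χ : DirichletCharacter ℂ N) (f : ℍ → ℂ) :
    Prop extends IsHarmonicMaassForm k N χ f where
  holomorphic : DifferentiableOn ℂ (f ∘ ofComplex) {z : ℂ | 0 < z.im}

/-- `q^n = e^{2πinz}`. -/
def qPow (n : ℤ) (z : ℍ) : ℂ := Complex.exp (2 * Real.pi * Complex.I * (n : ℂ) * (z : ℂ))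

/-- `f` has the Fourier expansion
`f(z) = ∑_{n ≥ -n₀} c⁺(n) q^n + ∑_{n ≥ 1} c⁻(n) Γ(1-k, 4πny) q^{-n}` (with `c⁺ = cp`, `c⁻ = cm`),
with both series absolutely convergent. -/
def HasFourierExpansion (k : ℝ) (n₀ : ℕ) (f : ℍ → ℂ) (cp : ℤ → ℂ) (cm : ℕ+ → ℂ) : Prop :=
  ∀ z : ℍ,
    Summable (fun n : Set.Ici (-(n₀ : ℤ)) => cp n * qPow n z) ∧
    Summable (fun n : ℕ+ =>
      cm n * ((upperGamma (1 - k) (4 * Real.pi * (n : ℝ) * z.im) : ℝ) : ℂ)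
        * qPow (-((n : ℕ) : ℤ)) z) ∧
    f z = (∑' n : Set.Ici (-(n₀ : ℤ)), cp n * qPow n z)
      + ∑' n : ℕ+, cm n * ((upperGamma (1 - k) (4 * Real.pi * (n : ℝ) * z.im) : ℝ) : ℂ)
        * qPow (-((n : ℕ) : ℤ)) z

/-- `D_n = C + 2πn/√N`. -/
def shiftD (C : ℝ) (N : ℕ) (n : ℝ) : ℝ := C + 2 * Real.pi * n / √(N : ℝ)

/-- The term of index `n` of the `c⁺`-series. -/
def termCp (C : ℝ) (N : ℕ) (X : ℝ) (cp : ℤ → ℂ) (n : ℤ) : ℂ :=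
  cp n * ((besselK 0 (2 * √(shiftD C N n * (C + √(N : ℝ) * X))) : ℝ) : ℂ)

/-- The term of index `n` of the `ℓ`-th `c⁻`-series. -/
def termCm (C : ℝ) (N : ℕ) (X : ℝ) (cm : ℕ+ → ℂ) (l : ℕ) (n : ℕ+) : ℂ :=
  cm n * (((n : ℝ) / √(shiftD C N n)) ^ l
    * besselK l (2 * √(shiftD C N n * (C + √(N : ℝ) * X))) : ℝ)

/-- The term of index `n` of the `d⁺`-series. -/
def termDp (k C : ℝ) (N : ℕ) (X : ℝ) (dp : ℤ → ℂ) (n : ℤ) : ℂ :=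
  dp n * ((√(N : ℝ) * X + shiftD C N n) ^ (-k / 2)
    * besselK k (2 * √(C * (shiftD C N n + √(N : ℝ) * X))) : ℝ)

/-- The term of index `n` of the `ℓ`-th `d⁻`-series. -/
def termDm (k C : ℝ) (N : ℕ) (X : ℝ) (dm : ℕ+ → ℂ) (l : ℕ) (n : ℕ+) : ℂ :=
  dm n * ((n : ℝ) ^ l * (shiftD C N n + √(N : ℝ) * X) ^ (-((l : ℝ) + k) / 2)
    * besselK (l + k) (2 * √(C * (shiftD C N n + √(N : ℝ) * X))) : ℝ)

end

/-! At z = it/√N the definition g = f|_k w_N reads f(i/(√N t)) = i^k t^k g(it/√N) for t > 0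
(`frickeSlash_imagPoint`). Multiply both sides by t^{-1} e^{-(C+√N X)t - C/t} and integrate over
(0,∞). Since ∫ t^{s-1} e^{-at-b/t} dt = 2 (b/a)^{s/2} K_s(2√(ab)) (`integral_besselKernel`), each
exponential e^{-2πny} turns into one Bessel term: on the left y = 1/(√N t) and C/t becomes D_n/t, on
the right y = t/√N and Ct becomes D_n t. For k = -m the function Γ(m+1, x) is e^{-x} times a
polynomial of degree m, so on the imaginary axis Γ(1-k, 4πny) q^{-n} is e^{-2πny} times a polynomial
in ny, whose monomials give the sums over ℓ.

Termwise integration (`hasSum_integral_besselKernel`) rests on at + b/t ≥ 2√(ab). Coefficients of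
size e^{C_f√n} are dominated once C_f < 2√(2πC/√N), which is the first lower bound on C; the second
one keeps every D_n positive.

No growth of c⁻ and d⁻ is assumed, so part (i) needs a proof that they are bounded, in the manner of
Hecke's bound for cusp forms. Write D = ∂_x + i∂_y. The equation Δ_{-m} f = 0 makes y^{-m} conj(Df)
holomorphic (`differentiableOn_xi`), and y^{1-m/2}|Df| is Γ₀(N)-invariant. Near a cusp f is a
holomorphic function, which D kills, plus an exponentially small error; `exists_xi_bound` converts
smallness of the error into smallness of Df. Hence the invariant norm is bounded on ℍ
(`exists_xiNorm_bound`), the same holds for g (`fricke_contDiffOn_and_xiNorm`), and Green's theorem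
for f q^n on [0,1] × [1/n, 2/n] bounds c⁻(n) (`exists_coeff_bound`). -/

section

open MeasureTheory Set Topology
open scoped ComplexConjugate

/-! ### Integral representation of the modified Bessel function -/

/-- The Bessel-type kernel `t^{s-1} e^{-at-b/t}`. -/
noncomputable def besselKernel (s a b t : ℝ) : ℝ := t ^ (s - 1) * Real.exp (-(a * t) - b / t)

lemma besselKernel_nonneg (s a b : ℝ) {t : ℝ} (ht : 0 < t) : 0 ≤ besselKernel s a b t := by
  unfold besselKernel; positivity

lemma continuousOn_besselKernel (s a b : ℝ) : ContinuousOn (besselKernel s a b) (Ioi 0) := by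
  intro t ht
  have h0 : t ≠ 0 := (mem_Ioi.1 ht).ne'
  unfold besselKernel
  refine ContinuousAt.continuousWithinAt ?_
  refine ContinuousAt.mul (Real.continuousAt_rpow_const _ _ (Or.inl h0)) ?_
  exact Real.continuous_exp.continuousAt.comp
    (((continuousAt_const.mul continuousAt_id).neg).sub (continuousAt_const.div continuousAt_id h0))

/-- Only t → 0 is delicate: e^{-b/t} ≤ (p!/b^p) t^p with p > -s raises the exponent above -1,
leaving a Gamma integral. -/
lemma integrableOn_besselKernel (s : ℝ) {a b : ℝ} (ha : 0 < a) (hb : 0 < b) :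
    IntegrableOn (besselKernel s a b) (Ioi 0) := by
  obtain ⟨p, hp⟩ := exists_nat_gt (-s)
  have h1 : IntegrableOn (fun t : ℝ => t ^ (s + p - 1) * Real.exp (-a * t)) (Ioi 0) := by
    simpa using integrableOn_rpow_mul_exp_neg_mul_rpow (p := 1) (s := s + p - 1) (b := a)
      (by linarith) one_pos ha
  refine Integrable.mono' (h1.const_mul (p.factorial / b ^ p))
    ((continuousOn_besselKernel s a b).aestronglyMeasurable measurableSet_Ioi) ?_
  filter_upwards [ae_restrict_mem measurableSet_Ioi] with t ht
  have ht : 0 < t := ht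
  rw [Real.norm_of_nonneg (besselKernel_nonneg s a b ht)]
  have h2 : (b / t) ^ p / p.factorial ≤ Real.exp (b / t) :=
    Real.pow_div_factorial_le_exp _ (by positivity) p
  have h3 : Real.exp (-(b / t)) ≤ p.factorial / b ^ p * t ^ p := by
    rw [Real.exp_neg]
    refine (inv_anti₀ (by positivity) h2).trans_eq ?_
    rw [div_pow]
    field_simp
  have h4 : t ^ (s + p - 1) = t ^ (s - 1) * t ^ p := by
    rw [← Real.rpow_natCast t p, ← Real.rpow_add ht]; ring_nf
  unfold besselKernel
  rw [sub_eq_add_neg (-(a * t)), Real.exp_add, h4]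
  calc t ^ (s - 1) * (Real.exp (-(a * t)) * Real.exp (-(b / t)))
      ≤ t ^ (s - 1) * (Real.exp (-(a * t)) * (p.factorial / b ^ p * t ^ p)) := by gcongr
    _ = _ := by rw [neg_mul]; ring

/-- The substitution t = √(b/a) e^u turns at + b/t into 2√(ab) cosh u; folding u and -u together
replaces e^{su} by 2 cosh(su). -/
lemma integral_besselKernel (s : ℝ) {a b : ℝ} (ha : 0 < a) (hb : 0 < b) :
    ∫ t in Ioi (0 : ℝ), besselKernel s a b t
      = 2 * (b / a) ^ (s / 2) * besselK s (2 * √(a * b)) := by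
  set c : ℝ := √(b / a) with hc
  have hc0 : 0 < c := Real.sqrt_pos.2 (by positivity)
  set x : ℝ := 2 * √(a * b) with hx
  have hac : a * c = √(a * b) := by
    rw [hc, Real.sqrt_div' _ ha.le, Real.sqrt_mul ha.le]
    have := Real.mul_self_sqrt ha.le
    have h : √a ≠ 0 := (Real.sqrt_pos.2 ha).ne'
    rw [mul_div_assoc', div_eq_iff h]
    linear_combination (-√b) * this
  have hbc : b / c = √(a * b) := by
    rw [hc, Real.sqrt_div' _ ha.le, Real.sqrt_mul ha.le]
    have := Real.mul_self_sqrt hb.le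
    have h : √b ≠ 0 := (Real.sqrt_pos.2 hb).ne'
    have h' : √a ≠ 0 := (Real.sqrt_pos.2 ha).ne'
    rw [div_eq_iff (div_ne_zero h h'), show √a * √b * (√b / √a) = √b * √b by field_simp, this]
  have himg : (fun u : ℝ => c * Real.exp u) '' univ = Ioi 0 := by
    ext t
    simp only [image_univ, mem_range, mem_Ioi]
    constructor
    · rintro ⟨u, rfl⟩; positivity
    · intro ht
      exact ⟨Real.log (t / c), by rw [Real.exp_log (by positivity)]; field_simp⟩
  have hder : ∀ u ∈ univ, HasDerivWithinAt (fun u : ℝ => c * Real.exp u) (c * Real.exp u) univ u :=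
    fun u _ => ((Real.hasDerivAt_exp u).const_mul c).hasDerivWithinAt
  have hinj : InjOn (fun u : ℝ => c * Real.exp u) univ := fun u _ v _ h =>
    Real.exp_injective (mul_left_cancel₀ hc0.ne' h)
  have hcs : (b / a) ^ (s / 2) = c ^ s := by
    rw [hc, Real.sqrt_eq_rpow, ← Real.rpow_mul (by positivity)]; ring_nf
  have hker : ∀ u : ℝ, |c * Real.exp u| • besselKernel s a b (c * Real.exp u)
      = c ^ s * (Real.exp (-x * Real.cosh u) * Real.exp (s * u)) := by
    intro u
    have h0 : 0 < c * Real.exp u := by positivity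
    have e1 : (c * Real.exp u) * (c * Real.exp u) ^ (s - 1) = c ^ s * Real.exp (s * u) := by
      rw [Real.rpow_sub_one h0.ne', mul_div_cancel₀ _ h0.ne', Real.mul_rpow hc0.le (Real.exp_pos u).le,
        ← Real.exp_mul, mul_comm u]
    have e2 : -(a * (c * Real.exp u)) - b / (c * Real.exp u) = -x * Real.cosh u := by
      rw [Real.cosh_eq, hx, Real.exp_neg]
      have : b / (c * Real.exp u) = √(a * b) * (Real.exp u)⁻¹ := by
        rw [← hbc]; field_simp
      rw [this]
      linear_combination (-Real.exp u) * hac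
    unfold besselKernel
    rw [abs_of_pos h0, smul_eq_mul, ← mul_assoc, e1, e2]; ring
  have hint : Integrable (fun u : ℝ => Real.exp (-x * Real.cosh u) * Real.exp (s * u)) := by
    have := (integrableOn_image_iff_integrableOn_abs_deriv_smul MeasurableSet.univ hder hinj
      (besselKernel s a b)).1 (himg ▸ integrableOn_besselKernel s ha hb)
    rw [integrableOn_univ] at this
    simp_rw [hker] at this
    have hne : c ^ s ≠ 0 := (Real.rpow_pos_of_pos hc0 s).ne'
    simpa [← mul_assoc, inv_mul_cancel₀ hne] using this.const_mul (c ^ s)⁻¹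
  have hsub := integral_image_eq_integral_abs_deriv_smul MeasurableSet.univ hder hinj
      (besselKernel s a b)
  rw [himg] at hsub
  rw [hsub, setIntegral_univ]
  simp_rw [hker]
  rw [integral_const_mul, hcs]
  have hsplit : ∫ u : ℝ, Real.exp (-x * Real.cosh u) * Real.exp (s * u) = 2 * besselK s x := by
    rw [← integral_add_compl measurableSet_Ioi (s := Ioi (0 : ℝ)) hint, compl_Ioi]
    have hneg : ∫ u in Iic (0 : ℝ), Real.exp (-x * Real.cosh u) * Real.exp (s * u)
        = ∫ u in Ioi (0 : ℝ), Real.exp (-x * Real.cosh u) * Real.exp (-(s * u)) := by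
      have := integral_comp_neg_Ioi (0 : ℝ)
        (fun u : ℝ => Real.exp (-x * Real.cosh u) * Real.exp (s * u))
      simp only [Real.cosh_neg, mul_neg, neg_zero] at this
      exact this.symm
    have hint' : Integrable (fun u : ℝ => Real.exp (-x * Real.cosh u) * Real.exp (-(s * u))) := by
      simpa using hint.comp_neg
    rw [hneg, ← integral_add hint.integrableOn hint'.integrableOn, besselK, ← integral_const_mul]
    refine integral_congr_ae (Eventually.of_forall fun u => ?_)
    simp only [Real.cosh_eq (s * u)]
    ring
  rw [hsplit]; ring

/-- Termwise integration of a series of Bessel kernels. -/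
theorem hasSum_integral_besselKernel {ι : Type*} [Countable ι] (c : ι → ℂ) (s : ℝ) {a₀ b₀ δ : ℝ}
    (a b : ι → ℝ) (ha₀ : 0 < a₀) (hb₀ : 0 < b₀) (ha : ∀ i, a₀ ≤ a i) (hb : ∀ i, b₀ ≤ b i)
    (hδ : 0 < δ) (hδ1 : δ < 1)
    (hS : Summable fun i => ‖c i‖ * Real.exp (-(2 * (1 - δ) * √(a i * b i)))) :
    (∀ t > 0, Summable fun i => c i * ((besselKernel s (a i) (b i) t : ℝ) : ℂ)) ∧
    IntegrableOn (fun t => ∑' i, c i * ((besselKernel s (a i) (b i) t : ℝ) : ℂ)) (Ioi 0) ∧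
    HasSum (fun i => c i *
        ((2 * (b i / a i) ^ (s / 2) * besselK s (2 * √(a i * b i)) : ℝ) : ℂ))
      (∫ t in Ioi (0 : ℝ), ∑' i, c i * ((besselKernel s (a i) (b i) t : ℝ) : ℂ)) := by
  set M : ι → ℝ := fun i => ‖c i‖ * Real.exp (-(2 * (1 - δ) * √(a i * b i))) with hM
  have hbd : ∀ t > 0, ∀ i, ‖c i * ((besselKernel s (a i) (b i) t : ℝ) : ℂ)‖
      ≤ M i * besselKernel s (δ * a₀) (δ * b₀) t := by
    intro t ht i
    have hai := ha₀.trans_le (ha i)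
    have hbi := hb₀.trans_le (hb i)
    rw [norm_mul, Complex.norm_real, Real.norm_of_nonneg (besselKernel_nonneg _ _ _ ht), hM]
    simp only [besselKernel]
    -- A share 1-δ of the exponent is spent on at + b/t ≥ 2√(ab), which gives a summable factor free
    -- of t; the share δ, with a and b replaced by their lower bounds, keeps an integrable kernel
    -- free of i.
    have key : Real.exp (-(a i * t) - b i / t) ≤ Real.exp (-(2 * (1 - δ) * √(a i * b i)))
        * Real.exp (-(δ * a₀ * t) - δ * b₀ / t) := by
      rw [← Real.exp_add, Real.exp_le_exp]
      have h1 : 2 * √(a i * b i) ≤ a i * t + b i / t := by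
        have e : a i * b i = (a i * t) * (b i / t) := by field_simp
        have hp : 0 ≤ a i * t := by positivity
        have hq : 0 ≤ b i / t := by positivity
        rw [e, Real.sqrt_mul hp]
        nlinarith [sq_nonneg (√(a i * t) - √(b i / t)), Real.sq_sqrt hp, Real.sq_sqrt hq]
      have h2 : δ * a₀ * t ≤ δ * (a i * t) := by
        rw [mul_assoc]; gcongr; exact ha i
      have h3 : δ * b₀ / t ≤ δ * (b i / t) := by
        rw [mul_div_assoc]; gcongr; exact hb i
      nlinarith [mul_le_mul_of_nonneg_left h1 (sub_pos.2 hδ1).le]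
    calc ‖c i‖ * (t ^ (s - 1) * Real.exp (-(a i * t) - b i / t))
        ≤ ‖c i‖ * (t ^ (s - 1) * (Real.exp (-(2 * (1 - δ) * √(a i * b i)))
        * Real.exp (-(δ * a₀ * t) - δ * b₀ / t))) := by gcongr
      _ = _ := by ring
  have hK := integrableOn_besselKernel s (mul_pos hδ ha₀) (mul_pos hδ hb₀)
  have hsum : ∀ t > 0, Summable fun i => c i * ((besselKernel s (a i) (b i) t : ℝ) : ℂ) :=
    fun t ht => Summable.of_norm_bounded (hS.mul_right _) (hbd t ht)
  have hmeas : ∀ i, AEStronglyMeasurable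
      (fun t => c i * ((besselKernel s (a i) (b i) t : ℝ) : ℂ)) (volume.restrict (Ioi 0)) :=
    fun i => (continuousOn_const.mul (Complex.continuous_ofReal.comp_continuousOn
      (continuousOn_besselKernel _ _ _))).aestronglyMeasurable measurableSet_Ioi
  refine ⟨hsum, ?_, ?_⟩
  · refine Integrable.mono' (hK.const_mul (∑' i, M i)) ?_ ?_
    · refine aestronglyMeasurable_of_tendsto_ae (u := atTop)
        (f := fun (S : Finset ι) t => ∑ i ∈ S, c i * ((besselKernel s (a i) (b i) t : ℝ) : ℂ))
        (fun S => Finset.aestronglyMeasurable_fun_sum S fun i _ => hmeas i) ?_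
      filter_upwards [ae_restrict_mem measurableSet_Ioi] with t ht
      exact (hsum t ht).hasSum
    · filter_upwards [ae_restrict_mem measurableSet_Ioi] with t ht
      rw [← tsum_mul_right]
      exact tsum_of_norm_bounded (hS.mul_right _).hasSum (hbd t ht)
  · have h := hasSum_integral_of_dominated_convergence (μ := volume.restrict (Ioi (0 : ℝ)))
      (F := fun i t => c i * ((besselKernel s (a i) (b i) t : ℝ) : ℂ))
      (f := fun t => ∑' i, c i * ((besselKernel s (a i) (b i) t : ℝ) : ℂ))
      (fun i t => M i * besselKernel s (δ * a₀) (δ * b₀) t) hmeas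
      (fun i => by
        filter_upwards [ae_restrict_mem measurableSet_Ioi] with t ht using hbd t ht i)
      (Eventually.of_forall fun t => hS.mul_right _)
      (by simp_rw [tsum_mul_right]; exact hK.const_mul _)
      (by filter_upwards [ae_restrict_mem measurableSet_Ioi] with t ht using (hsum t ht).hasSum)
    have e : (fun i => c i * ((2 * (b i / a i) ^ (s / 2) * besselK s (2 * √(a i * b i)) : ℝ) : ℂ))
        = fun i => ∫ t in Ioi (0 : ℝ), c i * ((besselKernel s (a i) (b i) t : ℝ) : ℂ) := by
      funext i
      rw [integral_const_mul, integral_complex_ofReal,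
        integral_besselKernel s (ha₀.trans_le (ha i)) (hb₀.trans_le (hb i))]
    rw [e]
    exact h

/-! ### Summability of series with square-root exponential growth -/

lemma summable_exp_neg_mul_sqrt {η : ℝ} (hη : 0 < η) :
    Summable fun n : ℕ => Real.exp (-(η * √(n : ℝ))) := by
  have h : Summable fun n : ℕ => (24 / η ^ 4) * (1 / (n : ℝ) ^ 2) :=
    (Real.summable_one_div_nat_pow.2 one_lt_two).mul_left _
  refine h.of_norm_bounded_eventually_nat ?_
  filter_upwards [eventually_gt_atTop 0] with n hn
  have hn : (0 : ℝ) < n := Nat.cast_pos.2 hn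
  have h1 := Real.pow_div_factorial_le_exp (η * √(n : ℝ)) (by positivity) 4
  have h2 : (η * √(n : ℝ)) ^ 4 = η ^ 4 * (n : ℝ) ^ 2 := by
    rw [mul_pow, show (√(n : ℝ)) ^ 4 = ((√(n : ℝ)) ^ 2) ^ 2 by ring, Real.sq_sqrt hn.le]
  rw [h2] at h1
  rw [Real.norm_of_nonneg (Real.exp_pos _).le, Real.exp_neg]
  refine (inv_anti₀ (by positivity) h1).trans_eq ?_
  simp [Nat.factorial]
  field_simp

lemma summable_norm_mul_exp_neg_sqrt {E : Type*} [SeminormedAddCommGroup E] {u : ℕ → E} {B B' : ℝ}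
    (hu : u =O[atTop] fun n : ℕ => Real.exp (B * √(n : ℝ))) (hB : B < B') :
    Summable fun n : ℕ => ‖u n‖ * Real.exp (-(B' * √(n : ℝ))) := by
  refine summable_of_isBigO_nat (summable_exp_neg_mul_sqrt (sub_pos.2 hB)) ?_
  refine (hu.norm_left.mul (isBigO_refl _ _)).congr_right fun n => ?_
  rw [← Real.exp_add]; ring_nf

lemma pow_isBigO_exp_sqrt (l : ℕ) {η : ℝ} (hη : 0 < η) :
    (fun n : ℕ => (n : ℝ) ^ l) =O[atTop] fun n : ℕ => Real.exp (η * √(n : ℝ)) := by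
  refine IsBigO.of_bound ((2 * l).factorial / η ^ (2 * l)) (Eventually.of_forall fun n => ?_)
  have h1 := Real.pow_div_factorial_le_exp (η * √(n : ℝ)) (by positivity) (2 * l)
  rw [mul_pow, pow_mul (√(n : ℝ)), Real.sq_sqrt (Nat.cast_nonneg n)] at h1
  rw [Real.norm_of_nonneg (by positivity), Real.norm_of_nonneg (Real.exp_pos _).le]
  calc (n : ℝ) ^ l = (2 * l).factorial / η ^ (2 * l) *
        (η ^ (2 * l) * (n : ℝ) ^ l / (2 * l).factorial) := by field_simp
    _ ≤ _ := by gcongr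

lemma summable_Ici_neg_iff {E : Type*} [AddCommGroup E] [TopologicalSpace E] [IsTopologicalAddGroup E]
    (n₀ : ℕ) (u : ℤ → E) :
    (Summable fun n : Set.Ici (-(n₀ : ℤ)) => u n) ↔ Summable fun n : ℕ => u n := by
  let e : ℕ ≃ Set.Ici (-(n₀ : ℤ)) :=
    { toFun := fun j => ⟨(j : ℤ) - n₀, by simp⟩
      invFun := fun n => ((n : ℤ) + n₀).toNat
      left_inv := fun j => by simp
      right_inv := fun n => by
        ext
        have : -(n₀ : ℤ) ≤ n := n.2
        simp only
        rw [Int.toNat_of_nonneg (by linarith)]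
        ring }
  rw [← e.summable_iff, ← summable_nat_add_iff n₀]
  simp [e]

/-- Makes room for the loss δ in the domination argument. The chosen δ puts T(1-δ) midway between
max(B, 0) and T; the maximum handles negative B. -/
lemma exists_lt_mul_one_sub {B T : ℝ} (hT : 0 < T) (hB : B < T) :
    ∃ δ : ℝ, 0 < δ ∧ δ < 1 ∧ B < T * (1 - δ) := by
  have hm : max B 0 < T := max_lt hB hT
  have h0 : 0 ≤ max B 0 := le_max_right _ _
  refine ⟨(T - max B 0) / (2 * T), by have := sub_pos.2 hm; positivity, ?_, ?_⟩
  · rw [div_lt_one (by positivity)]; linarith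
  · have : T * (1 - (T - max B 0) / (2 * T)) = (T + max B 0) / 2 := by field_simp; ring
    rw [this]; linarith [le_max_left B 0]

/-- Here p n is the product of the two kernel parameters; its linear growth with slope α makes the
Bessel decay at least e^{-2√α(1-δ)√n}, to be compared with e^{B√n}. -/
lemma summable_Ici_norm_mul_exp_neg (n₀ : ℕ) {u : ℤ → ℂ} {B δ α : ℝ}
    (hu : (fun n : ℕ => u n) =O[atTop] fun n : ℕ => Real.exp (B * √(n : ℝ))) (p : ℤ → ℝ)
    (hp : ∀ n : ℕ, α * n ≤ p n) (hα : 0 ≤ α) (hδ1 : δ < 1) (hB : B < 2 * √α * (1 - δ)) :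
    Summable fun n : Set.Ici (-(n₀ : ℤ)) => ‖u n‖ * Real.exp (-(2 * (1 - δ) * √(p n))) := by
  rw [summable_Ici_neg_iff n₀ (fun n => ‖u n‖ * Real.exp (-(2 * (1 - δ) * √(p n))))]
  refine Summable.of_nonneg_of_le (fun n => by positivity) (fun n => ?_)
    (summable_norm_mul_exp_neg_sqrt hu hB)
  have h1 : √α * √(n : ℝ) ≤ √(p n) := by
    rw [← Real.sqrt_mul hα]; exact Real.sqrt_le_sqrt (hp n)
  have h2 := mul_le_mul_of_nonneg_left h1 (show 0 ≤ 2 * (1 - δ) by linarith)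
  exact mul_le_mul_of_nonneg_left (Real.exp_le_exp.2 (by linarith)) (norm_nonneg _)

lemma summable_pnat_norm_mul_exp_neg {u : ℕ+ → ℂ} {K δ α : ℝ} (l : ℕ)
    (hu : ∀ n : ℕ+, ‖u n‖ ≤ K) (p : ℕ+ → ℝ)
    (hp : ∀ n : ℕ+, α * n ≤ p n) (hα : 0 < α) (hδ1 : δ < 1) :
    Summable fun n : ℕ+ =>
      ‖u n * ((n : ℝ) ^ l : ℝ)‖ * Real.exp (-(2 * (1 - δ) * √(p n))) := by
  have hT : 0 < 2 * (1 - δ) * √α := by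
    have := sub_pos.2 hδ1; have := Real.sqrt_pos.2 hα; positivity
  have hs := summable_norm_mul_exp_neg_sqrt (pow_isBigO_exp_sqrt l (half_pos hT)) (half_lt_self hT)
  refine Summable.of_nonneg_of_le (fun n => by positivity) (fun n => ?_)
    ((hs.comp_injective PNat.coe_injective).mul_left K)
  have h1 : √α * √(n : ℝ) ≤ √(p n) := by
    rw [← Real.sqrt_mul hα.le]; exact Real.sqrt_le_sqrt (hp n)
  have h2 := mul_le_mul_of_nonneg_left h1 (show 0 ≤ 2 * (1 - δ) by linarith)
  have hK : 0 ≤ K := (norm_nonneg _).trans (hu 1)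
  simp only [Function.comp_apply, norm_mul, Complex.norm_real]
  rw [← mul_assoc]
  refine mul_le_mul ?_ (Real.exp_le_exp.2 (by linarith)) (Real.exp_pos _).le (by positivity)
  exact mul_le_mul_of_nonneg_right (hu n) (norm_nonneg _)

/-! ### Symmetry of K in its order, and the incomplete Gamma function at positive integers. -/

lemma besselK_neg (ν x : ℝ) : besselK (-ν) x = besselK ν x := by
  simp [besselK, neg_mul, Real.cosh_neg]

/-- For a non-negative integer `m`, `Γ(m+1, x) = m! e^{-x} ∑_{l ≤ m} x^l / l!`. -/
lemma upperGamma_nat_add_one (m : ℕ) {x : ℝ} (hx : 0 < x) :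
    upperGamma (m + 1) x
      = ∑ l ∈ Finset.range (m + 1), (m.factorial : ℝ) / l.factorial * x ^ l * Real.exp (-x) := by
  set F : ℝ → ℝ := fun t =>
    -∑ l ∈ Finset.range (m + 1), (m.factorial : ℝ) / l.factorial * t ^ l * Real.exp (-t) with hF
  have hd : ∀ t ∈ Ici x, HasDerivAt F (t ^ m * Real.exp (-t)) t := by
    intro t _
    have h1 : ∀ l : ℕ, HasDerivAt (fun t : ℝ => (m.factorial : ℝ) / l.factorial * t ^ l
        * Real.exp (-t)) ((m.factorial : ℝ) / l.factorial * (l * t ^ (l - 1)) * Real.exp (-t)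
          + (m.factorial : ℝ) / l.factorial * t ^ l * (Real.exp (-t) * -1)) t := fun l =>
      ((hasDerivAt_pow l t).const_mul _).mul ((hasDerivAt_neg t).exp)
    have h2 := (HasDerivAt.fun_sum fun l (_ : l ∈ Finset.range (m + 1)) => h1 l).neg
    refine h2.congr_deriv ?_
    -- The derivatives telescope: the first half of the term l cancels the second half of the term l
    -- - 1, so only the top term remains.
    have h3 : ∀ M : ℕ, ∑ l ∈ Finset.range (M + 1),
        ((m.factorial : ℝ) / l.factorial * (l * t ^ (l - 1)) * Real.exp (-t)
          + (m.factorial : ℝ) / l.factorial * t ^ l * (Real.exp (-t) * -1))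
        = -((m.factorial : ℝ) / M.factorial * t ^ M * Real.exp (-t)) := by
      intro M
      induction M with
      | zero => simp
      | succ M ih =>
        rw [Finset.sum_range_succ, ih, Nat.factorial_succ]
        push_cast
        field_simp
        ring
    rw [h3 m, div_self (by positivity)]; ring
  have hlim : Tendsto F atTop (𝓝 0) := by
    have : Tendsto F atTop (𝓝 (-∑ l ∈ Finset.range (m + 1), (m.factorial : ℝ) / l.factorial * 0)) := by
      refine (tendsto_finsetSum _ fun l _ => ?_).neg
      simp_rw [mul_assoc]
      exact (Real.tendsto_pow_mul_exp_neg_atTop_nhds_zero l).const_mul _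
    simpa using this
  have h := integral_Ioi_of_hasDerivAt_of_nonneg' hd
    (fun t ht => by have : 0 < t := hx.trans ht; positivity) hlim
  rw [upperGamma]
  simp only [add_sub_cancel_right, Real.rpow_natCast]
  rw [h, hF]; simp

/-! ### The four families of series as Laplace-type integrals -/

section Series

variable {N : ℕ} {n₀ : ℕ} {C Cf X : ℝ}

lemma sqrt_natCast_pos (N : ℕ) [NeZero N] : 0 < √(N : ℝ) :=
  Real.sqrt_pos.2 (Nat.cast_pos.2 (Nat.pos_of_ne_zero (NeZero.ne N)))

lemma shiftD_eq (C : ℝ) (N : ℕ) (n : ℝ) : shiftD C N n = C + 2 * Real.pi / √(N : ℝ) * n := by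
  unfold shiftD; ring

lemma pos_of_max_lt
    (hC : max (Cf ^ 2 * √(N : ℝ) / (8 * Real.pi)) (2 * Real.pi * n₀ / √(N : ℝ)) < C) : 0 < C :=
  lt_of_le_of_lt (le_max_of_le_right (by positivity)) hC

lemma shiftD_neg_pos
    (hC : max (Cf ^ 2 * √(N : ℝ) / (8 * Real.pi)) (2 * Real.pi * n₀ / √(N : ℝ)) < C) :
    0 < shiftD C N (-(n₀ : ℝ)) := by
  have := (le_max_right _ _).trans_lt hC
  unfold shiftD
  rw [mul_neg, neg_div]; linarith

lemma shiftD_mono (C : ℝ) (N : ℕ) {m n : ℝ} (h : m ≤ n) : shiftD C N m ≤ shiftD C N n := by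
  unfold shiftD; gcongr

lemma le_shiftD (C : ℝ) (N : ℕ) {n : ℝ} (h : 0 ≤ n) : C ≤ shiftD C N n := by
  unfold shiftD; have : 0 ≤ 2 * Real.pi * n / √(N : ℝ) := by positivity
  linarith

lemma shiftD_neg_le_of_mem (C : ℝ) (N : ℕ) (n : Set.Ici (-(n₀ : ℤ))) :
    shiftD C N (-(n₀ : ℝ)) ≤ shiftD C N ((n : ℤ) : ℝ) :=
  shiftD_mono C N (by exact_mod_cast n.2)

/-- The first lower bound on C, rewritten as C_f² < 4C · 2π/√N. The right side is the square of the
Bessel decay rate in √n. -/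
lemma growth_lt [NeZero N]
    (hC : max (Cf ^ 2 * √(N : ℝ) / (8 * Real.pi)) (2 * Real.pi * n₀ / √(N : ℝ)) < C) :
    Cf < 2 * √(C * (2 * Real.pi / √(N : ℝ))) := by
  have hN := sqrt_natCast_pos N
  have h1 := (le_max_left _ _).trans_lt hC
  have h2 : 2 * √(C * (2 * Real.pi / √(N : ℝ))) = √(4 * (C * (2 * Real.pi / √(N : ℝ)))) := by
    rw [Real.sqrt_mul (by norm_num) (C * _), show (4 : ℝ) = 2 ^ 2 by norm_num,
      Real.sqrt_sq (by norm_num)]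
  rw [h2]
  refine Real.lt_sqrt_of_sq_lt ?_
  rw [div_lt_iff₀ (by positivity)] at h1
  rw [← mul_assoc, mul_div_assoc', lt_div_iff₀ hN]
  linarith

lemma exists_delta [NeZero N]
    (hC : max (Cf ^ 2 * √(N : ℝ) / (8 * Real.pi)) (2 * Real.pi * n₀ / √(N : ℝ)) < C) :
    ∃ δ : ℝ, 0 < δ ∧ δ < 1 ∧ Cf < 2 * √(C * (2 * Real.pi / √(N : ℝ))) * (1 - δ) := by
  have hN := sqrt_natCast_pos N
  have := pos_of_max_lt hC
  exact exists_lt_mul_one_sub (by positivity) (growth_lt hC)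

variable [NeZero N]

/-- Kernel parameters s = 0, a = C + √N X, b = D_n. Since s = 0 the factor (b/a)^{s/2} disappears,
and ab ≥ C(2π/√N) n for n ≥ 0. -/
theorem termCp_series {cp : ℤ → ℂ}
    (hcp : (fun n : ℕ => cp n) =O[atTop] (fun n : ℕ => Real.exp (Cf * √(n : ℝ))))
    (hC : max (Cf ^ 2 * √(N : ℝ) / (8 * Real.pi)) (2 * Real.pi * n₀ / √(N : ℝ)) < C)
    (hX : 0 < X) :
    Summable (fun n : Set.Ici (-(n₀ : ℤ)) => termCp C N X cp n) ∧
    IntegrableOn (fun t => ∑' n : Set.Ici (-(n₀ : ℤ)), cp n *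
      ((besselKernel 0 (C + √(N : ℝ) * X) (shiftD C N ((n : ℤ) : ℝ)) t : ℝ) : ℂ)) (Ioi 0) ∧
    ∫ t in Ioi (0 : ℝ), ∑' n : Set.Ici (-(n₀ : ℤ)), cp n *
      ((besselKernel 0 (C + √(N : ℝ) * X) (shiftD C N ((n : ℤ) : ℝ)) t : ℝ) : ℂ)
      = 2 * ∑' n : Set.Ici (-(n₀ : ℤ)), termCp C N X cp n := by
  have hN := sqrt_natCast_pos N
  have hC0 := pos_of_max_lt hC
  obtain ⟨δ, hδ, hδ1, hB⟩ := exists_delta hC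
  obtain ⟨-, h2, h3⟩ := hasSum_integral_besselKernel (fun n : Set.Ici (-(n₀ : ℤ)) => cp n) 0
    (fun _ => C + √(N : ℝ) * X) (fun n => shiftD C N ((n : ℤ) : ℝ))
    (show 0 < C + √(N : ℝ) * X by positivity) (shiftD_neg_pos hC) (fun _ => le_rfl)
    (fun n => shiftD_neg_le_of_mem C N n) hδ hδ1
    (summable_Ici_norm_mul_exp_neg n₀ hcp
      (fun n => (C + √(N : ℝ) * X) * shiftD C N (n : ℝ)) (fun n => by
        rw [shiftD_eq, mul_assoc]
        have h1 : C ≤ C + √(N : ℝ) * X := by have : 0 ≤ √(N : ℝ) * X := by positivity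
                                             linarith
        have h2 : 2 * Real.pi / √(N : ℝ) * n ≤ C + 2 * Real.pi / √(N : ℝ) * (n : ℤ) := by
          simp; linarith
        exact mul_le_mul h1 h2 (by positivity) (by positivity)) (by positivity) hδ1 hB)
  have e : (fun n : Set.Ici (-(n₀ : ℤ)) => cp n * ((2 * (shiftD C N ((n : ℤ) : ℝ) /
      (C + √(N : ℝ) * X)) ^ ((0 : ℝ) / 2) * besselK 0 (2 * √((C + √(N : ℝ) * X) *
        shiftD C N ((n : ℤ) : ℝ))) : ℝ) : ℂ)) = fun n : Set.Ici (-(n₀ : ℤ)) => 2 * termCp C N X cp n := by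
    funext n
    rw [termCp, mul_comm (C + √(N : ℝ) * X)]
    simp; ring
  simp only [e] at h3
  refine ⟨?_, h2, ?_⟩
  · simpa using h3.summable.mul_left (2⁻¹ : ℂ)
  · rw [← tsum_mul_left, h3.tsum_eq]

/-- Here s = k and the parameters have changed roles: a = D_n + √N X, b = C. The factor (b/a)^{k/2}
supplies both C^{k/2} and (√N X + D_n)^{-k/2}. -/
theorem termDp_series (k : ℝ) {dp : ℤ → ℂ}
    (hdp : (fun n : ℕ => dp n) =O[atTop] (fun n : ℕ => Real.exp (Cf * √(n : ℝ))))
    (hC : max (Cf ^ 2 * √(N : ℝ) / (8 * Real.pi)) (2 * Real.pi * n₀ / √(N : ℝ)) < C)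
    (hX : 0 < X) :
    Summable (fun n : Set.Ici (-(n₀ : ℤ)) => termDp k C N X dp n) ∧
    IntegrableOn (fun t => ∑' n : Set.Ici (-(n₀ : ℤ)), dp n *
      ((besselKernel k (shiftD C N ((n : ℤ) : ℝ) + √(N : ℝ) * X) C t : ℝ) : ℂ)) (Ioi 0) ∧
    ∫ t in Ioi (0 : ℝ), ∑' n : Set.Ici (-(n₀ : ℤ)), dp n *
      ((besselKernel k (shiftD C N ((n : ℤ) : ℝ) + √(N : ℝ) * X) C t : ℝ) : ℂ)
      = 2 * (((C ^ (k / 2) : ℝ) : ℂ) * ∑' n : Set.Ici (-(n₀ : ℤ)), termDp k C N X dp n) := by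
  have hN := sqrt_natCast_pos N
  have hC0 := pos_of_max_lt hC
  have hX' : 0 ≤ √(N : ℝ) * X := by positivity
  obtain ⟨δ, hδ, hδ1, hB⟩ := exists_delta hC
  obtain ⟨-, h2, h3⟩ := hasSum_integral_besselKernel (fun n : Set.Ici (-(n₀ : ℤ)) => dp n) k
    (fun n => shiftD C N ((n : ℤ) : ℝ) + √(N : ℝ) * X) (fun _ => C)
    (shiftD_neg_pos hC) hC0 (fun n => by
      have := shiftD_neg_le_of_mem C N n
      linarith) (fun _ => le_rfl) hδ hδ1
    (summable_Ici_norm_mul_exp_neg n₀ hdp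
      (fun n => (shiftD C N (n : ℝ) + √(N : ℝ) * X) * C) (fun n => by
        rw [shiftD_eq, mul_comm _ C, mul_assoc]
        have h2 : 2 * Real.pi / √(N : ℝ) * n
            ≤ C + 2 * Real.pi / √(N : ℝ) * (n : ℤ) + √(N : ℝ) * X := by
          simp; linarith
        exact mul_le_mul_of_nonneg_left h2 hC0.le) (by positivity) hδ1 hB)
  have e : (fun n : Set.Ici (-(n₀ : ℤ)) => dp n * ((2 * (C / (shiftD C N ((n : ℤ) : ℝ)
      + √(N : ℝ) * X)) ^ (k / 2) * besselK k (2 * √((shiftD C N ((n : ℤ) : ℝ) + √(N : ℝ) * X)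
        * C)) : ℝ) : ℂ)) = fun n : Set.Ici (-(n₀ : ℤ)) =>
          (2 * ((C ^ (k / 2) : ℝ) : ℂ)) * termDp k C N X dp n := by
    funext n
    have hD : 0 < shiftD C N ((n : ℤ) : ℝ) + √(N : ℝ) * X := by
      have := shiftD_neg_le_of_mem C N n
      have := shiftD_neg_pos hC
      linarith
    rw [termDp, mul_comm _ C, Real.div_rpow hC0.le hD.le, neg_div, Real.rpow_neg (by linarith),
      add_comm (√(N : ℝ) * X)]
    push_cast; ring
  simp only [e] at h3
  have hc : (2 * ((C ^ (k / 2) : ℝ) : ℂ)) ≠ 0 := by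
    have := (Real.rpow_pos_of_pos hC0 (k / 2)).ne'
    exact mul_ne_zero two_ne_zero (Complex.ofReal_ne_zero.2 this)
  refine ⟨?_, h2, ?_⟩
  · exact (summable_mul_left_iff hc).1 h3.summable
  · rw [← mul_assoc, ← tsum_mul_left, h3.tsum_eq]

/-- With s = -l the factor (b/a)^{-l/2} is √(C+√N X)^l / √(D_n)^l, and K_{-l} = K_l. Bounded
coefficients leave room to spare, so δ = 1/2 serves for every C > 0. -/
theorem termCm_series {cm : ℕ+ → ℂ} {K : ℝ} (hcm : ∀ n, ‖cm n‖ ≤ K) (hC : 0 < C) (hX : 0 < X)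
    (l : ℕ) :
    Summable (termCm C N X cm l) ∧
    (∀ t > 0, Summable fun n : ℕ+ => cm n * (((n : ℝ) ^ l : ℝ) : ℂ) *
      ((besselKernel (-l) (C + √(N : ℝ) * X) (shiftD C N n) t : ℝ) : ℂ)) ∧
    IntegrableOn (fun t => ∑' n : ℕ+, cm n * (((n : ℝ) ^ l : ℝ) : ℂ) *
      ((besselKernel (-l) (C + √(N : ℝ) * X) (shiftD C N n) t : ℝ) : ℂ)) (Ioi 0) ∧
    ∫ t in Ioi (0 : ℝ), ∑' n : ℕ+, cm n * (((n : ℝ) ^ l : ℝ) : ℂ) *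
      ((besselKernel (-l) (C + √(N : ℝ) * X) (shiftD C N n) t : ℝ) : ℂ)
      = 2 * (((√(C + √(N : ℝ) * X) ^ l : ℝ) : ℂ) * ∑' n : ℕ+, termCm C N X cm l n) := by
  have hN := sqrt_natCast_pos N
  have hX' : 0 ≤ √(N : ℝ) * X := by positivity
  have ha : 0 < C + √(N : ℝ) * X := by linarith
  obtain ⟨h1, h2, h3⟩ := hasSum_integral_besselKernel
    (fun n : ℕ+ => cm n * (((n : ℝ) ^ l : ℝ) : ℂ)) (-l)
    (fun _ => C + √(N : ℝ) * X) (fun n => shiftD C N n)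
    ha hC (fun _ => le_rfl)
    (fun n => le_shiftD C N (Nat.cast_nonneg _)) one_half_pos one_half_lt_one
    (summable_pnat_norm_mul_exp_neg l hcm
      (fun n => (C + √(N : ℝ) * X) * shiftD C N (n : ℝ))
      (α := C * (2 * Real.pi / √(N : ℝ))) (fun n => by
        rw [shiftD_eq, mul_assoc]
        exact mul_le_mul (by linarith) (by linarith) (by positivity) (by positivity))
        (by positivity) one_half_lt_one)
  have e : (fun n : ℕ+ => cm n * (((n : ℝ) ^ l : ℝ) : ℂ) * ((2 * (shiftD C N n /
      (C + √(N : ℝ) * X)) ^ ((-l : ℝ) / 2) * besselK (-l) (2 * √((C + √(N : ℝ) * X) *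
        shiftD C N n)) : ℝ) : ℂ)) = fun n => (2 * ((√(C + √(N : ℝ) * X) ^ l : ℝ) : ℂ)) *
          termCm C N X cm l n := by
    funext n
    have hD : 0 < shiftD C N n := hC.trans_le (le_shiftD C N (Nat.cast_nonneg _))
    have h : (shiftD C N n / (C + √(N : ℝ) * X)) ^ ((-l : ℝ) / 2)
        = √(C + √(N : ℝ) * X) ^ l / √(shiftD C N n) ^ l := by
      rw [neg_div, Real.rpow_neg (by positivity), ← Real.inv_rpow (by positivity), inv_div,
        Real.div_rpow ha.le hD.le, Real.rpow_div_two_eq_sqrt _ ha.le,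
        Real.rpow_div_two_eq_sqrt _ hD.le, Real.rpow_natCast, Real.rpow_natCast]
    rw [termCm, mul_comm (C + √(N : ℝ) * X), besselK_neg, h, div_pow]
    push_cast; ring
  simp only [e] at h3
  have hc : (2 * ((√(C + √(N : ℝ) * X) ^ l : ℝ) : ℂ)) ≠ 0 := by
    have := (pow_pos (Real.sqrt_pos.2 ha) l).ne'
    exact mul_ne_zero two_ne_zero (Complex.ofReal_ne_zero.2 this)
  refine ⟨(summable_mul_left_iff hc).1 h3.summable, h1, h2, ?_⟩
  rw [← mul_assoc, ← tsum_mul_left, h3.tsum_eq]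

/-- Now s = l + k, and C^{(l+k)/2} splits as C^{k/2} √C^l; the second factor joins the constant
(4π/√N)^l in the final formula. -/
theorem termDm_series (k : ℝ) {dm : ℕ+ → ℂ} {K : ℝ} (hdm : ∀ n, ‖dm n‖ ≤ K) (hC : 0 < C)
    (hX : 0 < X) (l : ℕ) :
    Summable (termDm k C N X dm l) ∧
    (∀ t > 0, Summable fun n : ℕ+ => dm n * (((n : ℝ) ^ l : ℝ) : ℂ) *
      ((besselKernel (l + k) (shiftD C N n + √(N : ℝ) * X) C t : ℝ) : ℂ)) ∧
    IntegrableOn (fun t => ∑' n : ℕ+, dm n * (((n : ℝ) ^ l : ℝ) : ℂ) *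
      ((besselKernel (l + k) (shiftD C N n + √(N : ℝ) * X) C t : ℝ) : ℂ)) (Ioi 0) ∧
    ∫ t in Ioi (0 : ℝ), ∑' n : ℕ+, dm n * (((n : ℝ) ^ l : ℝ) : ℂ) *
      ((besselKernel (l + k) (shiftD C N n + √(N : ℝ) * X) C t : ℝ) : ℂ)
      = 2 * (((C ^ (k / 2) : ℝ) : ℂ) * ((√C ^ l : ℝ) : ℂ) * ∑' n : ℕ+, termDm k C N X dm l n) := by
  have hN := sqrt_natCast_pos N
  have hX' : 0 ≤ √(N : ℝ) * X := by positivity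
  obtain ⟨h1, h2, h3⟩ := hasSum_integral_besselKernel
    (fun n : ℕ+ => dm n * (((n : ℝ) ^ l : ℝ) : ℂ)) (l + k)
    (fun n => shiftD C N n + √(N : ℝ) * X) (fun _ => C)
    hC hC
    (fun n => by have := le_shiftD C N (Nat.cast_nonneg (α := ℝ) n); linarith)
    (fun _ => le_rfl) one_half_pos one_half_lt_one
    (summable_pnat_norm_mul_exp_neg l hdm
      (fun n => (shiftD C N (n : ℝ) + √(N : ℝ) * X) * C)
      (α := C * (2 * Real.pi / √(N : ℝ))) (fun n => by
        rw [shiftD_eq, mul_comm _ C, mul_assoc]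
        exact mul_le_mul_of_nonneg_left (by linarith) hC.le)
        (by positivity) one_half_lt_one)
  have e : (fun n : ℕ+ => dm n * (((n : ℝ) ^ l : ℝ) : ℂ) * ((2 * (C / (shiftD C N n
      + √(N : ℝ) * X)) ^ ((l + k) / 2) * besselK (l + k) (2 * √((shiftD C N n + √(N : ℝ) * X) *
        C)) : ℝ) : ℂ)) = fun n => (2 * (((C ^ (k / 2) : ℝ) : ℂ) * ((√C ^ l : ℝ) : ℂ))) *
          termDm k C N X dm l n := by
    funext n
    have hD : 0 < shiftD C N n + √(N : ℝ) * X := by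
      have := le_shiftD C N (Nat.cast_nonneg (α := ℝ) n); linarith
    have h : C ^ ((l + k) / 2) = C ^ (k / 2) * √C ^ l := by
      rw [← Real.rpow_natCast, Real.sqrt_eq_rpow, ← Real.rpow_mul hC.le, ← Real.rpow_add hC]
      ring_nf
    rw [termDm, mul_comm _ C, Real.div_rpow hC.le hD.le, h, neg_div, Real.rpow_neg hD.le]
    push_cast; ring
  simp only [e] at h3
  have hc : (2 * (((C ^ (k / 2) : ℝ) : ℂ) * ((√C ^ l : ℝ) : ℂ))) ≠ 0 := by
    have h4 := (Real.rpow_pos_of_pos hC (k / 2)).ne'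
    have h5 := (pow_pos (Real.sqrt_pos.2 hC) l).ne'
    exact mul_ne_zero two_ne_zero (mul_ne_zero (Complex.ofReal_ne_zero.2 h4)
      (Complex.ofReal_ne_zero.2 h5))
  refine ⟨(summable_mul_left_iff hc).1 h3.summable, h1, h2, ?_⟩
  rw [← mul_assoc, ← tsum_mul_left, h3.tsum_eq]

end Series

/-! ### Comparison of the two sides on the imaginary axis -/

/-- The point `i y` of the upper half-plane. -/
noncomputable def imagPoint (y : ℝ) (hy : 0 < y) : ℍ := ⟨Complex.I * y, by simpa using hy⟩

lemma qPow_imagPoint (n : ℤ) {y : ℝ} (hy : 0 < y) :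
    qPow n (imagPoint y hy) = ((Real.exp (-(2 * Real.pi * n * y)) : ℝ) : ℂ) := by
  rw [qPow, imagPoint, Complex.ofReal_exp]
  congr 1
  push_cast
  have := Complex.I_mul_I
  change 2 * Real.pi * Complex.I * n * (Complex.I * y) = _
  linear_combination (2 * Real.pi * n * y : ℂ) * this

lemma im_imagPoint {y : ℝ} (hy : 0 < y) : (imagPoint y hy).im = y := by
  change (Complex.I * (y : ℂ)).im = y
  simp

lemma expansion_imagPoint {k : ℝ} {n₀ : ℕ} {f : ℍ → ℂ} {cp : ℤ → ℂ} {cm : ℕ+ → ℂ}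
    (h : HasFourierExpansion k n₀ f cp cm) {y : ℝ} (hy : 0 < y) :
    f (imagPoint y hy) = (∑' n : Set.Ici (-(n₀ : ℤ)), cp n *
        ((Real.exp (-(2 * Real.pi * ((n : ℤ) : ℝ) * y)) : ℝ) : ℂ))
      + ∑' n : ℕ+, cm n * ((upperGamma (1 - k) (4 * Real.pi * n * y) *
        Real.exp (2 * Real.pi * n * y) : ℝ) : ℂ) := by
  rw [(h (imagPoint y hy)).2.2]
  simp only [qPow_imagPoint, im_imagPoint]
  congr 1
  refine tsum_congr fun n => ?_
  push_cast
  ring_nf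

/-- For z = it/√N one has Nz = i√N t and -1/(Nz) = i/(√N t), so the Fricke involution acts on the
imaginary axis by t ↦ 1/t. -/
lemma frickeSlash_imagPoint (k : ℝ) (N : ℕ) [NeZero N] (f : ℍ → ℂ) {t : ℝ} (ht : 0 < t)
    (h1 : 0 < 1 / (√(N : ℝ) * t)) (h2 : 0 < t / √(N : ℝ)) :
    f (imagPoint (1 / (√(N : ℝ) * t)) h1)
      = Complex.I ^ (k : ℂ) * (((t ^ k : ℝ) : ℂ) *
        frickeSlash k N f (imagPoint (t / √(N : ℝ)) h2)) := by
  have hN := sqrt_natCast_pos N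
  have hNN : (N : ℝ) = √(N : ℝ) * √(N : ℝ) := (Real.mul_self_sqrt (Nat.cast_nonneg N)).symm
  have e1 : (N : ℂ) * ((imagPoint (t / √(N : ℝ)) h2 : ℍ) : ℂ)
      = ((√(N : ℝ) * t : ℝ) : ℂ) * Complex.I := by
    have h : (N : ℝ) * (t / √(N : ℝ)) = √(N : ℝ) * t := by
      rw [mul_div_assoc', div_eq_iff hN.ne']; nth_rewrite 1 [hNN]; ring
    rw [← h]
    change (N : ℂ) * (Complex.I * ((t / √(N : ℝ) : ℝ) : ℂ)) = _
    push_cast; ring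
  have e2 : (⟨-1 / ((N : ℂ) * ((imagPoint (t / √(N : ℝ)) h2 : ℍ) : ℂ)), fricke_im_pos N _⟩ : ℍ)
      = imagPoint (1 / (√(N : ℝ) * t)) h1 := by
    ext1
    change -1 / ((N : ℂ) * ((imagPoint (t / √(N : ℝ)) h2 : ℍ) : ℂ))
      = Complex.I * ((1 / (√(N : ℝ) * t) : ℝ) : ℂ)
    rw [e1]
    have h0 : ((√(N : ℝ) * t : ℝ) : ℂ) ≠ 0 := Complex.ofReal_ne_zero.2 (by positivity)
    rw [Complex.ofReal_div, Complex.ofReal_one, div_eq_iff (mul_ne_zero h0 Complex.I_ne_zero)]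
    field_simp
    simp
  -- A positive real factor does not move the argument, so the principal power splits even for
  -- half-integral k.
  have e3 : (((√(N : ℝ) * t : ℝ) : ℂ) * Complex.I) ^ (-(k : ℂ))
      = (((√(N : ℝ) * t) ^ (-k) : ℝ) : ℂ) * (Complex.I ^ (k : ℂ))⁻¹ := by
    have h0 : 0 < √(N : ℝ) * t := by positivity
    have h0' : ((√(N : ℝ) * t : ℝ) : ℂ) ≠ 0 := Complex.ofReal_ne_zero.2 h0.ne'
    rw [← Complex.cpow_neg, Complex.ofReal_cpow h0.le, Complex.ofReal_neg,
      Complex.cpow_def_of_ne_zero (mul_ne_zero h0' Complex.I_ne_zero),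
      Complex.cpow_def_of_ne_zero h0', Complex.cpow_def_of_ne_zero Complex.I_ne_zero,
      Complex.log_ofReal_mul h0 Complex.I_ne_zero, Complex.ofReal_log h0.le, add_mul,
      Complex.exp_add]
  have e4 : (N : ℝ) ^ (k / 2) = √(N : ℝ) ^ k := Real.rpow_div_two_eq_sqrt k (Nat.cast_nonneg N)
  have e5 : t ^ k * (√(N : ℝ) ^ k * (√(N : ℝ) * t) ^ (-k)) = 1 := by
    rw [Real.rpow_neg (by positivity), Real.mul_rpow hN.le ht.le]
    have := (Real.rpow_pos_of_pos ht k).ne'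
    have := (Real.rpow_pos_of_pos hN k).ne'
    field_simp
  have hI : Complex.I ^ (k : ℂ) ≠ 0 := by simp [Complex.cpow_eq_zero_iff]
  have e5' := congrArg ((↑) : ℝ → ℂ) e5
  simp only [Complex.ofReal_mul, Complex.ofReal_one] at e5'
  rw [frickeSlash, e2, e1, e3, e4]
  simp only [Complex.ofReal_mul] at *
  field_simp
  linear_combination (-f (imagPoint (1 / (√(N : ℝ) * t)) h1)) * e5'

section Kernels

variable {N : ℕ} [NeZero N] {C X t : ℝ}

/-- D_x/t = C/t + 2πx/(√N t), so the exponential at height y = 1/(√N t) is absorbed into the kernel;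
t^{-l} is, up to a constant, the power y^l from the incomplete Gamma polynomial. -/
lemma besselKernel_left (C : ℝ) (N : ℕ) (a x : ℝ) (l : ℕ) (ht : 0 < t) :
    besselKernel (-l) a (shiftD C N x) t = besselKernel 0 a C t *
      ((1 / t) ^ l * Real.exp (-(2 * Real.pi * x * (1 / (√(N : ℝ) * t))))) := by
  unfold besselKernel
  have e1 : -(a * t) - shiftD C N x / t
      = (-(a * t) - C / t) + -(2 * Real.pi * x * (1 / (√(N : ℝ) * t))) := by
    unfold shiftD; field_simp; ring
  have e2 : t ^ (-(l : ℝ) - 1) = t ^ ((0 : ℝ) - 1) * (1 / t) ^ l := by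
    rw [show -(l : ℝ) - 1 = (0 - 1) + -(l : ℝ) by ring, Real.rpow_add ht, Real.rpow_neg ht.le,
      Real.rpow_natCast, one_div, inv_pow]
  rw [e1, e2, Real.exp_add]; ring

/-- The analogue at height y = t/√N, where D_x t = Ct + 2πxt/√N. The factor t^k comes from the
Fricke relation and t^l from y^l. -/
lemma besselKernel_right (C : ℝ) (N : ℕ) (X k x : ℝ) (l : ℕ) (ht : 0 < t) :
    besselKernel (l + k) (shiftD C N x + √(N : ℝ) * X) C t
      = besselKernel 0 (C + √(N : ℝ) * X) C t * (t ^ k *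
      (t ^ l * Real.exp (-(2 * Real.pi * x * (t / √(N : ℝ)))))) := by
  unfold besselKernel
  have e1 : -((shiftD C N x + √(N : ℝ) * X) * t) - C / t
      = (-((C + √(N : ℝ) * X) * t) - C / t) + -(2 * Real.pi * x * (t / √(N : ℝ))) := by
    unfold shiftD; ring
  have e2 : t ^ ((l : ℝ) + k - 1) = t ^ ((0 : ℝ) - 1) * (t ^ k * t ^ l) := by
    rw [show (l : ℝ) + k - 1 = (0 - 1) + (k + l) by ring, Real.rpow_add ht, Real.rpow_add ht,
      Real.rpow_natCast]
  rw [e1, e2, Real.exp_add]; ring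

lemma tsum_left_plus (cp : ℤ → ℂ) (n₀ : ℕ) (C : ℝ) (N : ℕ) (a : ℝ) (ht : 0 < t) :
    ∑' n : Set.Ici (-(n₀ : ℤ)), cp n * ((besselKernel 0 a (shiftD C N ((n : ℤ) : ℝ)) t : ℝ) : ℂ)
      = ((besselKernel 0 a C t : ℝ) : ℂ) * ∑' n : Set.Ici (-(n₀ : ℤ)), cp n *
        ((Real.exp (-(2 * Real.pi * ((n : ℤ) : ℝ) * (1 / (√(N : ℝ) * t)))) : ℝ) : ℂ) := by
  rw [← tsum_mul_left]
  refine tsum_congr fun n => ?_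
  have := besselKernel_left C N a ((n : ℤ) : ℝ) 0 ht
  rw [Nat.cast_zero, neg_zero] at this
  rw [this]
  push_cast; ring

lemma tsum_right_plus (dp : ℤ → ℂ) (n₀ : ℕ) (C : ℝ) (N : ℕ) (X k : ℝ) (ht : 0 < t) :
    ∑' n : Set.Ici (-(n₀ : ℤ)), dp n *
        ((besselKernel k (shiftD C N ((n : ℤ) : ℝ) + √(N : ℝ) * X) C t : ℝ) : ℂ)
      = ((besselKernel 0 (C + √(N : ℝ) * X) C t : ℝ) : ℂ) * (((t ^ k : ℝ) : ℂ) *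
        ∑' n : Set.Ici (-(n₀ : ℤ)), dp n *
        ((Real.exp (-(2 * Real.pi * ((n : ℤ) : ℝ) * (t / √(N : ℝ)))) : ℝ) : ℂ)) := by
  rw [← tsum_mul_left, ← tsum_mul_left]
  refine tsum_congr fun n => ?_
  have := besselKernel_right C N X k ((n : ℤ) : ℝ) 0 ht
  rw [Nat.cast_zero, zero_add] at this
  rw [this]
  push_cast; ring

/-- With x = 2πny the decay e^{-2x} of the incomplete Gamma function outweighs the growth e^x of
q^{-n}; what is left has the same exponential e^{-2πny} as q^n. -/
lemma upperGamma_mul_exp (m : ℕ) {x : ℝ} (hx : 0 < x) :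
    upperGamma (1 - -(m : ℝ)) (2 * x) * Real.exp x
      = ∑ l ∈ Finset.range (m + 1), (m.factorial : ℝ) / l.factorial * (2 * x) ^ l * Real.exp (-x) := by
  rw [show 1 - -(m : ℝ) = m + 1 by ring, upperGamma_nat_add_one m (by positivity), Finset.sum_mul]
  refine Finset.sum_congr rfl fun l _ => ?_
  rw [mul_assoc, ← Real.exp_add]; ring_nf

lemma tsum_left_minus {cm : ℕ+ → ℂ} {K : ℝ} (hcm : ∀ n, ‖cm n‖ ≤ K) (hC : 0 < C) (hX : 0 < X)
    (m : ℕ) (ht : 0 < t) :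
    ∑ l ∈ Finset.range (m + 1),
        (((m.factorial : ℝ) / l.factorial * (4 * Real.pi / √(N : ℝ)) ^ l : ℝ) : ℂ) *
        ∑' n : ℕ+, cm n * (((n : ℝ) ^ l : ℝ) : ℂ) *
          ((besselKernel (-l) (C + √(N : ℝ) * X) (shiftD C N n) t : ℝ) : ℂ)
      = ((besselKernel 0 (C + √(N : ℝ) * X) C t : ℝ) : ℂ) *
        ∑' n : ℕ+, cm n * ((upperGamma (1 - -(m : ℝ)) (4 * Real.pi * n * (1 / (√(N : ℝ) * t))) *
        Real.exp (2 * Real.pi * n * (1 / (√(N : ℝ) * t))) : ℝ) : ℂ) := by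
  have hN := sqrt_natCast_pos N
  simp_rw [← tsum_mul_left]
  rw [← Summable.tsum_finsetSum fun l _ =>
    ((termCm_series (N := N) hcm hC hX l).2.1 t ht).mul_left _]
  refine tsum_congr fun n => ?_
  have hn : (0 : ℝ) < n := Nat.cast_pos.2 n.pos
  rw [show 4 * Real.pi * n * (1 / (√(N : ℝ) * t)) = 2 * (2 * Real.pi * n * (1 / (√(N : ℝ) * t)))
    by ring, upperGamma_mul_exp m (by positivity), Complex.ofReal_sum, Finset.mul_sum,
    Finset.mul_sum]
  refine Finset.sum_congr rfl fun l _ => ?_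
  rw [besselKernel_left C N _ _ l ht]
  have : (2 * (2 * Real.pi * n * (1 / (√(N : ℝ) * t)))) ^ l
      = (4 * Real.pi / √(N : ℝ)) ^ l * (n : ℝ) ^ l * (1 / t) ^ l := by
    rw [← mul_pow, ← mul_pow]; congr 1; field_simp; ring
  rw [this]
  push_cast; ring

lemma tsum_right_minus {dm : ℕ+ → ℂ} {K : ℝ} (hdm : ∀ n, ‖dm n‖ ≤ K) (hC : 0 < C) (hX : 0 < X)
    (k : ℝ) (m : ℕ) (ht : 0 < t) :
    ∑ l ∈ Finset.range (m + 1),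
        (((m.factorial : ℝ) / l.factorial * (4 * Real.pi / √(N : ℝ)) ^ l : ℝ) : ℂ) *
        ∑' n : ℕ+, dm n * (((n : ℝ) ^ l : ℝ) : ℂ) *
          ((besselKernel (l + k) (shiftD C N n + √(N : ℝ) * X) C t : ℝ) : ℂ)
      = ((besselKernel 0 (C + √(N : ℝ) * X) C t : ℝ) : ℂ) * (((t ^ k : ℝ) : ℂ) *
        ∑' n : ℕ+, dm n * ((upperGamma (1 - -(m : ℝ)) (4 * Real.pi * n * (t / √(N : ℝ))) *
        Real.exp (2 * Real.pi * n * (t / √(N : ℝ))) : ℝ) : ℂ)) := by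
  have hN := sqrt_natCast_pos N
  simp_rw [← tsum_mul_left]
  rw [← Summable.tsum_finsetSum fun l _ =>
    ((termDm_series (N := N) k hdm hC hX l).2.1 t ht).mul_left _]
  refine tsum_congr fun n => ?_
  have hn : (0 : ℝ) < n := Nat.cast_pos.2 n.pos
  rw [show 4 * Real.pi * n * (t / √(N : ℝ)) = 2 * (2 * Real.pi * n * (t / √(N : ℝ)))
    by ring, upperGamma_mul_exp m (by positivity), Complex.ofReal_sum, Finset.mul_sum,
    Finset.mul_sum, Finset.mul_sum]
  refine Finset.sum_congr rfl fun l _ => ?_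
  rw [besselKernel_right C N X k _ l ht]
  have : (2 * (2 * Real.pi * n * (t / √(N : ℝ)))) ^ l
      = (4 * Real.pi / √(N : ℝ)) ^ l * (n : ℝ) ^ l * t ^ l := by
    rw [← mul_pow, ← mul_pow]; congr 1; field_simp; ring
  rw [this]
  push_cast; ring

end Kernels

/-! ### The two summation formulas, given bounds on the coefficients. -/

theorem weaklyHolomorphic_identity {N : ℕ} [NeZero N] {n₀ : ℕ} {C Cf X : ℝ} (k : ℝ)
    {cp dp : ℤ → ℂ}
    (hcp : (fun n : ℕ => cp n) =O[atTop] (fun n : ℕ => Real.exp (Cf * √(n : ℝ))))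
    (hdp : (fun n : ℕ => dp n) =O[atTop] (fun n : ℕ => Real.exp (Cf * √(n : ℝ))))
    (hC : max (Cf ^ 2 * √(N : ℝ) / (8 * Real.pi)) (2 * Real.pi * n₀ / √(N : ℝ)) < C)
    {f : ℍ → ℂ} (hf : HasFourierExpansion k n₀ f cp 0)
    (hg : HasFourierExpansion k n₀ (frickeSlash k N f) dp 0) (hX : 0 < X) :
    Summable (fun n : Set.Ici (-(n₀ : ℤ)) => termCp C N X cp n) ∧
    Summable (fun n : Set.Ici (-(n₀ : ℤ)) => termDp k C N X dp n) ∧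
    (∑' n : Set.Ici (-(n₀ : ℤ)), termCp C N X cp n)
      = Complex.I ^ (k : ℂ) * ((C ^ (k / 2) : ℝ) : ℂ)
        * ∑' n : Set.Ici (-(n₀ : ℤ)), termDp k C N X dp n := by
  have hN := sqrt_natCast_pos N
  obtain ⟨s1, i1, e1⟩ := termCp_series hcp hC hX
  obtain ⟨s2, i2, e2⟩ := termDp_series k hdp hC hX
  refine ⟨s1, s2, ?_⟩
  have key : ∫ t in Ioi (0 : ℝ), ∑' n : Set.Ici (-(n₀ : ℤ)), cp n *
      ((besselKernel 0 (C + √(N : ℝ) * X) (shiftD C N ((n : ℤ) : ℝ)) t : ℝ) : ℂ)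
      = ∫ t in Ioi (0 : ℝ), Complex.I ^ (k : ℂ) * ∑' n : Set.Ici (-(n₀ : ℤ)), dp n *
      ((besselKernel k (shiftD C N ((n : ℤ) : ℝ) + √(N : ℝ) * X) C t : ℝ) : ℂ) := by
    refine setIntegral_congr_fun measurableSet_Ioi fun t ht => ?_
    have ht : 0 < t := ht
    have h1 : 0 < 1 / (√(N : ℝ) * t) := by positivity
    have h2 : 0 < t / √(N : ℝ) := by positivity
    have hrel := frickeSlash_imagPoint k N f ht h1 h2
    rw [expansion_imagPoint hf h1, expansion_imagPoint hg h2] at hrel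
    simp only [Pi.zero_apply, zero_mul, tsum_zero, add_zero] at hrel
    simp only [tsum_left_plus cp n₀ C N _ ht, tsum_right_plus dp n₀ C N X k ht, hrel]
    ring
  rw [integral_const_mul, e1, e2] at key
  refine mul_left_cancel₀ (two_ne_zero (α := ℂ)) (key.trans ?_)
  ring

theorem harmonicMaass_identity {N : ℕ} [NeZero N] {n₀ : ℕ} {C Cf X K K' : ℝ} (m : ℕ)
    {cp dp : ℤ → ℂ} {cm dm : ℕ+ → ℂ}
    (hcp : (fun n : ℕ => cp n) =O[atTop] (fun n : ℕ => Real.exp (Cf * √(n : ℝ))))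
    (hdp : (fun n : ℕ => dp n) =O[atTop] (fun n : ℕ => Real.exp (Cf * √(n : ℝ))))
    (hcm : ∀ n, ‖cm n‖ ≤ K) (hdm : ∀ n, ‖dm n‖ ≤ K')
    (hC : max (Cf ^ 2 * √(N : ℝ) / (8 * Real.pi)) (2 * Real.pi * n₀ / √(N : ℝ)) < C)
    {f : ℍ → ℂ} (hf : HasFourierExpansion (-(m : ℝ)) n₀ f cp cm)
    (hg : HasFourierExpansion (-(m : ℝ)) n₀ (frickeSlash (-(m : ℝ)) N f) dp dm) (hX : 0 < X) :
    Summable (fun n : Set.Ici (-(n₀ : ℤ)) => termCp C N X cp n) ∧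
    (∀ l ∈ Finset.range (m + 1), Summable (termCm C N X cm l)) ∧
    Summable (fun n : Set.Ici (-(n₀ : ℤ)) => termDp (-(m : ℝ)) C N X dp n) ∧
    (∀ l ∈ Finset.range (m + 1), Summable (termDm (-(m : ℝ)) C N X dm l)) ∧
    (∑' n : Set.Ici (-(n₀ : ℤ)), termCp C N X cp n)
      + ∑ l ∈ Finset.range (m + 1),
          (((m.factorial : ℝ) / (l.factorial : ℝ)
            * (4 * Real.pi * √C / √(N : ℝ) * √(1 + √(N : ℝ) * X / C)) ^ l : ℝ) : ℂ)
          * ∑' n : ℕ+, termCm C N X cm l n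
    = Complex.I ^ ((-(m : ℝ) : ℝ) : ℂ) * ((C ^ (-(m : ℝ) / 2) : ℝ) : ℂ)
        * ∑' n : Set.Ici (-(n₀ : ℤ)), termDp (-(m : ℝ)) C N X dp n
      + Complex.I ^ ((-(m : ℝ) : ℝ) : ℂ) * ((C ^ (-(m : ℝ) / 2) : ℝ) : ℂ)
        * ∑ l ∈ Finset.range (m + 1),
          (((m.factorial : ℝ) / (l.factorial : ℝ)
            * (4 * Real.pi * √C / √(N : ℝ)) ^ l : ℝ) : ℂ)
          * ∑' n : ℕ+, termDm (-(m : ℝ)) C N X dm l n := by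
  have hN := sqrt_natCast_pos N
  have hC0 := pos_of_max_lt hC
  set k : ℝ := -(m : ℝ) with hk
  obtain ⟨s1, i1, e1⟩ := termCp_series hcp hC hX
  obtain ⟨s2, i2, e2⟩ := termDp_series k hdp hC hX
  have hc := termCm_series (N := N) hcm hC0 hX
  have hd := termDm_series (N := N) k hdm hC0 hX
  refine ⟨s1, fun l _ => (hc l).1, s2, fun l _ => (hd l).1, ?_⟩
  have hL : ∫ t in Ioi (0 : ℝ), ((∑' n : Set.Ici (-(n₀ : ℤ)), cp n *
      ((besselKernel 0 (C + √(N : ℝ) * X) (shiftD C N ((n : ℤ) : ℝ)) t : ℝ) : ℂ))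
      + ∑ l ∈ Finset.range (m + 1),
        (((m.factorial : ℝ) / l.factorial * (4 * Real.pi / √(N : ℝ)) ^ l : ℝ) : ℂ) *
        ∑' n : ℕ+, cm n * (((n : ℝ) ^ l : ℝ) : ℂ) *
          ((besselKernel (-l) (C + √(N : ℝ) * X) (shiftD C N n) t : ℝ) : ℂ))
      = 2 * ((∑' n : Set.Ici (-(n₀ : ℤ)), termCp C N X cp n)
      + ∑ l ∈ Finset.range (m + 1),
          (((m.factorial : ℝ) / (l.factorial : ℝ)
            * (4 * Real.pi * √C / √(N : ℝ) * √(1 + √(N : ℝ) * X / C)) ^ l : ℝ) : ℂ)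
          * ∑' n : ℕ+, termCm C N X cm l n) := by
    rw [integral_add i1 (integrable_finsetSum _ fun l _ => (hc l).2.2.1.const_mul _), e1,
      integral_finsetSum _ fun l _ => (hc l).2.2.1.const_mul _, mul_add, Finset.mul_sum]
    congr 1
    refine Finset.sum_congr rfl fun l _ => ?_
    rw [integral_const_mul, (hc l).2.2.2]
    have : 4 * Real.pi * √C / √(N : ℝ) * √(1 + √(N : ℝ) * X / C)
        = 4 * Real.pi / √(N : ℝ) * √(C + √(N : ℝ) * X) := by
      rw [show C + √(N : ℝ) * X = C * (1 + √(N : ℝ) * X / C) by field_simp, Real.sqrt_mul hC0.le]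
      ring
    rw [this, mul_pow]
    push_cast; ring
  have hR : ∫ t in Ioi (0 : ℝ), ((∑' n : Set.Ici (-(n₀ : ℤ)), dp n *
      ((besselKernel k (shiftD C N ((n : ℤ) : ℝ) + √(N : ℝ) * X) C t : ℝ) : ℂ))
      + ∑ l ∈ Finset.range (m + 1),
        (((m.factorial : ℝ) / l.factorial * (4 * Real.pi / √(N : ℝ)) ^ l : ℝ) : ℂ) *
        ∑' n : ℕ+, dm n * (((n : ℝ) ^ l : ℝ) : ℂ) *
          ((besselKernel (l + k) (shiftD C N n + √(N : ℝ) * X) C t : ℝ) : ℂ))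
      = 2 * (((C ^ (k / 2) : ℝ) : ℂ) * ((∑' n : Set.Ici (-(n₀ : ℤ)), termDp k C N X dp n)
      + ∑ l ∈ Finset.range (m + 1),
          (((m.factorial : ℝ) / (l.factorial : ℝ)
            * (4 * Real.pi * √C / √(N : ℝ)) ^ l : ℝ) : ℂ)
          * ∑' n : ℕ+, termDm k C N X dm l n)) := by
    rw [integral_add i2 (integrable_finsetSum _ fun l _ => (hd l).2.2.1.const_mul _), e2,
      integral_finsetSum _ fun l _ => (hd l).2.2.1.const_mul _, mul_add, mul_add, Finset.mul_sum,
      Finset.mul_sum]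
    congr 1
    refine Finset.sum_congr rfl fun l _ => ?_
    rw [integral_const_mul, (hd l).2.2.2]
    have : 4 * Real.pi * √C / √(N : ℝ) = 4 * Real.pi / √(N : ℝ) * √C := by ring
    rw [this, mul_pow]
    push_cast; ring
  -- For each t both integrands equal the common kernel t^{-1} e^{-(C+√N X)t - C/t} times the two
  -- sides of the Fricke relation.
  have key := setIntegral_congr_fun (μ := volume) (measurableSet_Ioi (a := (0 : ℝ)))
    (f := fun t : ℝ => (∑' n : Set.Ici (-(n₀ : ℤ)), cp n *
      ((besselKernel 0 (C + √(N : ℝ) * X) (shiftD C N ((n : ℤ) : ℝ)) t : ℝ) : ℂ))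
      + ∑ l ∈ Finset.range (m + 1),
        (((m.factorial : ℝ) / l.factorial * (4 * Real.pi / √(N : ℝ)) ^ l : ℝ) : ℂ) *
        ∑' n : ℕ+, cm n * (((n : ℝ) ^ l : ℝ) : ℂ) *
          ((besselKernel (-l) (C + √(N : ℝ) * X) (shiftD C N n) t : ℝ) : ℂ))
    (g := fun t : ℝ => Complex.I ^ (k : ℂ) * ((∑' n : Set.Ici (-(n₀ : ℤ)), dp n *
      ((besselKernel k (shiftD C N ((n : ℤ) : ℝ) + √(N : ℝ) * X) C t : ℝ) : ℂ))
      + ∑ l ∈ Finset.range (m + 1),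
        (((m.factorial : ℝ) / l.factorial * (4 * Real.pi / √(N : ℝ)) ^ l : ℝ) : ℂ) *
        ∑' n : ℕ+, dm n * (((n : ℝ) ^ l : ℝ) : ℂ) *
          ((besselKernel (l + k) (shiftD C N n + √(N : ℝ) * X) C t : ℝ) : ℂ)))
    (fun t ht => by
      have ht : 0 < t := ht
      have h1 : 0 < 1 / (√(N : ℝ) * t) := by positivity
      have h2 : 0 < t / √(N : ℝ) := by positivity
      have hrel := frickeSlash_imagPoint k N f ht h1 h2
      rw [expansion_imagPoint hf h1, expansion_imagPoint hg h2] at hrel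
      simp only [tsum_left_plus cp n₀ C N _ ht, tsum_right_plus dp n₀ C N X k ht,
        tsum_left_minus hcm hC0 hX m ht, tsum_right_minus hdm hC0 hX k m ht]
      rw [← mul_add, hrel]
      ring)
  rw [integral_const_mul, hL, hR] at key
  refine mul_left_cancel₀ (two_ne_zero (α := ℂ)) (key.trans ?_)
  ring

/-! ### The Cauchy–Riemann operator -/

/-- The operator `∂/∂x + i ∂/∂y`, i.e. twice the Wirtinger derivative `∂/∂z̄`. -/
noncomputable def dbar (F : ℂ → ℂ) (z : ℂ) : ℂ := partialX F z + Complex.I * partialY F z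

lemma realLinear_apply (L : ℂ →L[ℝ] ℂ) (w : ℂ) : L w = w.re * L 1 + w.im * L Complex.I := by
  conv_lhs => rw [← Complex.re_add_im w]
  rw [map_add, ← Complex.real_smul, ← mul_one (w.re : ℂ), ← Complex.real_smul, map_smul, map_smul]
  simp

lemma dbar_congr {F G : ℂ → ℂ} {z : ℂ} (h : F =ᶠ[𝓝 z] G) : dbar F z = dbar G z := by
  simp only [dbar, partialX, partialY, h.fderiv_eq]

lemma dbar_mul {F G : ℂ → ℂ} {z : ℂ} (hF : DifferentiableAt ℝ F z) (hG : DifferentiableAt ℝ G z) :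
    dbar (fun w => F w * G w) z = dbar F z * G z + F z * dbar G z := by
  simp only [dbar, partialX, partialY, fderiv_fun_mul hF hG]
  simp
  ring

lemma dbar_sub {F G : ℂ → ℂ} {z : ℂ} (hF : DifferentiableAt ℝ F z) (hG : DifferentiableAt ℝ G z) :
    dbar (fun w => F w - G w) z = dbar F z - dbar G z := by
  simp only [dbar, partialX, partialY, fderiv_fun_sub hF hG]
  simp
  ring

lemma dbar_const_mul {F : ℂ → ℂ} {z : ℂ} (c : ℂ) (hF : DifferentiableAt ℝ F z) :
    dbar (fun w => c * F w) z = c * dbar F z := by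
  simp only [dbar, partialX, partialY, fderiv_const_mul hF]
  simp
  ring

lemma dbar_eq_zero {F : ℂ → ℂ} {z : ℂ} (hF : DifferentiableAt ℂ F z) : dbar F z = 0 := by
  have := (differentiableAt_complex_iff_differentiableAt_real.1 hF).2
  simp only [dbar, partialX, partialY, this, smul_eq_mul, ← mul_assoc, Complex.I_mul_I]
  ring

/-- A holomorphic φ involves z̄ only through conj φ, so the chain rule contributes the single factor
conj φ'. -/
lemma dbar_comp {φ F : ℂ → ℂ} {z : ℂ} (hφ : DifferentiableAt ℂ φ z)
    (hF : DifferentiableAt ℝ F (φ z)) :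
    dbar (fun w => F (φ w)) z = dbar F (φ z) * conj (deriv φ z) := by
  have h1 : fderiv ℝ (fun w => F (φ w)) z = (fderiv ℝ F (φ z)).comp (fderiv ℝ φ z) :=
    fderiv_comp z hF (hφ.restrictScalars ℝ)
  have h2 : ∀ v, fderiv ℝ φ z v = v * deriv φ z := by
    intro v
    rw [hφ.fderiv_restrictScalars ℝ]
    simp
  simp only [dbar, partialX, partialY, h1, ContinuousLinearMap.comp_apply, h2, one_mul]
  rw [realLinear_apply _ (deriv φ z), realLinear_apply _ (Complex.I * deriv φ z)]
  set A := fderiv ℝ F (φ z) 1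
  set B := fderiv ℝ F (φ z) Complex.I
  have hc : conj (deriv φ z) = (deriv φ z).re - (deriv φ z).im * Complex.I := by
    apply Complex.ext <;> simp
  rw [hc]
  simp
  linear_combination ((deriv φ z).im * B) * Complex.I_sq

lemma dbar_mul_comp {u φ F : ℂ → ℂ} {z : ℂ} (hu : DifferentiableAt ℂ u z)
    (hφ : DifferentiableAt ℂ φ z) (hF : DifferentiableAt ℝ F (φ z)) :
    dbar (fun w => u w * F (φ w)) z = u z * (dbar F (φ z) * conj (deriv φ z)) := by
  have h : DifferentiableAt ℝ (fun w => F (φ w)) z := hF.comp z (hφ.restrictScalars ℝ)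
  rw [dbar_mul (hu.restrictScalars ℝ) h, dbar_eq_zero hu, dbar_comp hφ hF]
  ring

/-- Green's theorem on a rectangle. -/
lemma integral_rect_eq_dbar (F : ℂ → ℂ) (a b c d : ℝ) {U : Set ℂ} (hU : IsOpen U)
    (hF : ContDiffOn ℝ 1 F U) (hsub : uIcc a b ×ℂ uIcc c d ⊆ U) :
    (∫ x : ℝ in a..b, F (x + c * Complex.I)) - (∫ x : ℝ in a..b, F (x + d * Complex.I)) +
      Complex.I • (∫ y : ℝ in c..d, F (b + y * Complex.I)) -
      Complex.I • (∫ y : ℝ in c..d, F (a + y * Complex.I)) =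
      ∫ x : ℝ in a..b, ∫ y : ℝ in c..d, Complex.I * dbar F (x + y * Complex.I) := by
  have hcd : ContinuousOn (fderiv ℝ F) U := hF.continuousOn_fderiv_of_isOpen hU le_rfl
  have hcont : ContinuousOn (fun z => Complex.I • fderiv ℝ F z 1 - fderiv ℝ F z Complex.I) U :=
    ((hcd.clm_apply continuousOn_const).const_smul Complex.I).sub
      (hcd.clm_apply continuousOn_const)
  have e : ∀ p, Complex.I • fderiv ℝ F p 1 - fderiv ℝ F p Complex.I = Complex.I * dbar F p := by
    intro p
    simp only [dbar, partialX, partialY, smul_eq_mul]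
    linear_combination (-fderiv ℝ F p Complex.I) * Complex.I_sq
  have h := Complex.integral_boundary_rect_of_differentiableOn_real F ⟨a, c⟩ ⟨b, d⟩
    ((hF.differentiableOn one_ne_zero).mono hsub)
    ((hcont.mono hsub).integrableOn_compact (isCompact_uIcc.reProdIm isCompact_uIcc))
  simp only [e] at h
  exact h

lemma continuousOn_dbar {F : ℂ → ℂ} {U : Set ℂ} (hU : IsOpen U) (hF : ContDiffOn ℝ 1 F U) :
    ContinuousOn (dbar F) U := by
  have hcd : ContinuousOn (fderiv ℝ F) U := hF.continuousOn_fderiv_of_isOpen hU le_rfl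
  exact (hcd.clm_apply continuousOn_const).add
    (continuousOn_const.mul (hcd.clm_apply continuousOn_const))

/-- If `Δ_{-m} F = 0` then `y^{-m} conj ((∂_x + i ∂_y) F)` is holomorphic. -/
lemma differentiableOn_xi (m : ℕ) {F : ℂ → ℂ} (hF : ContDiffOn ℝ ∞ F {z : ℂ | 0 < z.im})
    (hL : ∀ z : ℂ, 0 < z.im → hypLaplacian (-(m : ℝ)) F z = 0) :
    DifferentiableOn ℂ (fun z => (((z.im)⁻¹ ^ m : ℝ) : ℂ) * conj (dbar F z)) {z : ℂ | 0 < z.im} := by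
  have hU : IsOpen {z : ℂ | 0 < z.im} := isOpen_lt continuous_const Complex.continuous_im
  intro z hz
  have hz' : 0 < z.im := hz
  refine DifferentiableAt.differentiableWithinAt ?_
  have hFz : ContDiffAt ℝ ∞ F z := hF.contDiffAt (hU.mem_nhds hz)
  have hd : DifferentiableAt ℝ (fderiv ℝ F) z :=
    (hFz.fderiv_right (m := 1) (by norm_cast)).differentiableAt one_ne_zero
  have hdX : ∀ v, DifferentiableAt ℝ (fun w => fderiv ℝ F w v) z := fun v =>
    hd.clm_apply (differentiableAt_const v)
  have hdXv : ∀ v w, fderiv ℝ (fun x => fderiv ℝ F x v) z w = fderiv ℝ (fderiv ℝ F) z w v := by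
    intro v w
    rw [fderiv_clm_apply hd (differentiableAt_const v)]
    simp
  have hsymm : fderiv ℝ (fderiv ℝ F) z Complex.I 1 = fderiv ℝ (fderiv ℝ F) z 1 Complex.I := by
    have := (hFz.isSymmSndFDerivAt (by simp; norm_cast)).eq Complex.I 1
    exact this
  have hD : HasFDerivAt (dbar F) (fderiv ℝ (dbar F) z) z := by
    have : DifferentiableAt ℝ (dbar F) z := (hdX 1).add ((hdX Complex.I).const_mul Complex.I)
    exact this.hasFDerivAt
  have hDv : ∀ w, fderiv ℝ (dbar F) z w = fderiv ℝ (fderiv ℝ F) z w 1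
      + Complex.I * fderiv ℝ (fderiv ℝ F) z w Complex.I := by
    intro w
    have : fderiv ℝ (dbar F) z = fderiv ℝ (fun x => fderiv ℝ F x 1) z
        + Complex.I • fderiv ℝ (fun x => fderiv ℝ F x Complex.I) z :=
      ((hdX 1).hasFDerivAt.add ((hdX Complex.I).hasFDerivAt.const_mul Complex.I)).fderiv
    rw [this]
    simp [hdXv]
  have hy : HasFDerivAt (fun w : ℂ => (((w.im)⁻¹ ^ m : ℝ) : ℂ))
      ((Complex.ofRealCLM.comp ((m * (z.im)⁻¹ ^ (m - 1) * -(z.im ^ 2)⁻¹ : ℝ) • Complex.imCLM))) z := by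
    have h1 : HasDerivAt (fun y : ℝ => y⁻¹ ^ m) (m * (z.im)⁻¹ ^ (m - 1) * -(z.im ^ 2)⁻¹) z.im :=
      (hasDerivAt_inv hz'.ne').fun_pow m
    exact Complex.ofRealCLM.hasFDerivAt.comp z (h1.comp_hasFDerivAt z Complex.imCLM.hasFDerivAt)
  have hconj : HasFDerivAt (fun w => conj (dbar F w))
      ((Complex.conjCLE : ℂ →L[ℝ] ℂ).comp (fderiv ℝ (dbar F) z)) z :=
    (Complex.conjCLE : ℂ →L[ℝ] ℂ).hasFDerivAt.comp z hD
  have hh := hy.mul hconj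
  refine differentiableAt_complex_iff_differentiableAt_real.2 ⟨hh.differentiableAt, ?_⟩
  have hL' := hL z hz'
  rw [hypLaplacian] at hL'
  have e : fderiv ℝ (fun z => (((z.im)⁻¹ ^ m : ℝ) : ℂ) * conj (dbar F z)) z = _ := hh.fderiv
  rw [e]
  have hX2 : partialX (partialX F) z = fderiv ℝ (fderiv ℝ F) z 1 1 := hdXv 1 1
  have hY2 : partialY (partialY F) z = fderiv ℝ (fderiv ℝ F) z Complex.I Complex.I :=
    hdXv Complex.I Complex.I
  rw [hX2, hY2, show partialX F z + Complex.I * partialY F z = dbar F z from rfl] at hL'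
  have hyc : (z.im : ℂ) ≠ 0 := Complex.ofReal_ne_zero.2 hz'.ne'
  -- Since (∂_y + i∂_x)(∂_x + i∂_y) = i(∂_x² + ∂_y²), by symmetry of second derivatives, the Laplace
  -- equation becomes first order in `dbar F`. Its conjugate is the Cauchy–Riemann equation for
  -- y^{-m} conj(`dbar F`).
  have key : (z.im : ℂ) * (fderiv ℝ (dbar F) z Complex.I + Complex.I * fderiv ℝ (dbar F) z 1)
      = m * dbar F z := by
    rw [hDv, hDv, hsymm]
    refine mul_left_cancel₀ hyc ?_
    push_cast at hL'
    linear_combination (-Complex.I) * hL' + (z.im ^ 2 * fderiv ℝ (fderiv ℝ F) z 1 Complex.I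
      - m * z.im * dbar F z) * Complex.I_sq
  have key' := congrArg conj key
  simp only [map_mul, map_add, Complex.conj_ofReal, Complex.conj_I, map_natCast] at key'
  -- For m = 0 the exponent m - 1 is truncated to 0, which the factor m renders harmless.
  have hpow : (m : ℂ) * ((z.im : ℂ) ^ (m - 1))⁻¹ * ((z.im : ℂ) ^ 2)⁻¹
      = m * ((z.im : ℂ) ^ m)⁻¹ * (z.im : ℂ)⁻¹ := by
    rcases m with _ | m
    · simp
    · rw [Nat.add_sub_cancel, pow_succ]
      field_simp
      ring
  have hyy := mul_inv_cancel₀ hyc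
  simp
  linear_combination ((z.im : ℂ) ^ m)⁻¹ * (z.im : ℂ)⁻¹ * key' - conj (dbar F z) * hpow
    - ((z.im : ℂ) ^ m)⁻¹ * (conj (fderiv ℝ (dbar F) z Complex.I)
      - Complex.I * conj (fderiv ℝ (dbar F) z 1)) * hyy

/-! ### An interior estimate -/

/-- A smooth radial bump function supported in the unit disc. -/
noncomputable def radialBump (w : ℂ) : ℝ := Real.smoothTransition (1 - ‖w‖ ^ 2)

lemma contDiff_radialBump : ContDiff ℝ ∞ radialBump :=
  Real.smoothTransition.contDiff.comp (contDiff_const.sub (contDiff_norm_sq ℝ))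

lemma radialBump_nonneg (w : ℂ) : 0 ≤ radialBump w := Real.smoothTransition.nonneg _

lemma radialBump_le_one (w : ℂ) : radialBump w ≤ 1 := Real.smoothTransition.le_one _

lemma radialBump_eq_zero {w : ℂ} (hw : 1 ≤ ‖w‖) : radialBump w = 0 :=
  Real.smoothTransition.zero_of_nonpos (by nlinarith)

lemma radialBump_pos {w : ℂ} (hw : ‖w‖ < 1) : 0 < radialBump w :=
  Real.smoothTransition.pos_of_pos (by nlinarith [norm_nonneg w])

lemma integral_radialBump_pos : 0 < ∫ w, radialBump w := by
  refine contDiff_radialBump.continuous.integral_pos_of_hasCompactSupport_nonneg_nonzero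
    (HasCompactSupport.intro (isCompact_closedBall (0 : ℂ) 1) fun w hw => ?_)
    radialBump_nonneg (x := 0) (radialBump_pos (by simp)).ne'
  refine radialBump_eq_zero ?_
  simp only [Metric.mem_closedBall, dist_zero_right, not_le] at hw
  exact hw.le

/-- The closed unit disc about z₀ lies in Im z ≥ 1, so cut-off functions vanish near the real line
and are continuous on all of ℂ. -/
lemma continuous_of_eq_zero_off_ball {H : ℂ → ℂ} {z₀ : ℂ} (hz₀ : 2 ≤ z₀.im)
    (hc : ContinuousOn H {z : ℂ | 0 < z.im}) (h0 : ∀ z, 1 < ‖z - z₀‖ → H z = 0) :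
    Continuous H := by
  have hU : IsOpen {z : ℂ | 0 < z.im} := isOpen_lt continuous_const Complex.continuous_im
  refine continuous_iff_continuousAt.2 fun z => ?_
  by_cases hz : 0 < z.im
  · exact hc.continuousAt (hU.mem_nhds hz)
  · have h1 : 1 < ‖z - z₀‖ := by
      have := Complex.abs_im_le_norm (z - z₀)
      rw [Complex.sub_im, abs_sub_comm] at this
      have := le_abs_self (z₀.im - z.im)
      linarith
    have h2 : H =ᶠ[𝓝 z] fun _ => 0 := by
      have : {w : ℂ | 1 < ‖w - z₀‖} ∈ 𝓝 z :=
        (isOpen_lt continuous_const (by fun_prop)).mem_nhds h1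
      filter_upwards [this] with w hw using h0 w hw
    exact continuousAt_const.congr h2.symm

lemma hasCompactSupport_of_eq_zero_off_ball {H : ℂ → ℂ} {z₀ : ℂ}
    (h0 : ∀ z, 1 < ‖z - z₀‖ → H z = 0) : HasCompactSupport H :=
  HasCompactSupport.intro (isCompact_closedBall z₀ 1) fun w hw => h0 w (by
    simpa [dist_eq_norm] using hw)

/-- Half-width 3/2 leaves a margin around the unit disc, so no mass is lost; as Im z₀ ≥ 2 in the
application, the rectangle still lies in the half-plane. -/
lemma integral_rect_eq_integral {H : ℂ → ℂ} {z₀ : ℂ} (hc : Continuous H)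
    (h0 : ∀ z, 1 < ‖z - z₀‖ → H z = 0) :
    ∫ x : ℝ in (z₀.re - 3 / 2)..(z₀.re + 3 / 2), ∫ y : ℝ in (z₀.im - 3 / 2)..(z₀.im + 3 / 2),
      H (x + y * Complex.I) = ∫ z, H z := by
  have hint : Integrable H := hc.integrable_of_hasCompactSupport
    (hasCompactSupport_of_eq_zero_off_ball h0)
  have hre : ∀ x y : ℝ, 1 < |x - z₀.re| → H (x + y * Complex.I) = 0 := by
    intro x y hx
    refine h0 _ (hx.trans_le ?_)
    simpa using Complex.abs_re_le_norm (x + y * Complex.I - z₀)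
  have him : ∀ x y : ℝ, 1 < |y - z₀.im| → H (x + y * Complex.I) = 0 := by
    intro x y hy
    refine h0 _ (hy.trans_le ?_)
    simpa using Complex.abs_im_le_norm (x + y * Complex.I - z₀)
  have h1 : ∀ x : ℝ, ∫ y : ℝ in (z₀.im - 3 / 2)..(z₀.im + 3 / 2), H (x + y * Complex.I)
      = ∫ y : ℝ, H (x + y * Complex.I) := by
    intro x
    refine intervalIntegral.integral_eq_integral_of_support_subset fun y hy => ?_
    by_contra hcon
    refine hy (him x y ?_)
    by_contra h
    have := abs_le.1 (not_lt.1 h)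
    exact hcon ⟨by linarith [this.1], by linarith [this.2]⟩
  simp_rw [h1]
  rw [intervalIntegral.integral_eq_integral_of_support_subset fun x hx => ?_]
  · have hvp := Complex.volume_preserving_equiv_real_prod.symm
    have e : ∀ p : ℝ × ℝ, Complex.measurableEquivRealProd.symm p
        = (p.1 : ℂ) + p.2 * Complex.I := fun p => by
      apply Complex.ext <;> simp [Complex.measurableEquivRealProd]
    have h2 := hvp.integral_comp Complex.measurableEquivRealProd.symm.measurableEmbedding H
    have h3 : Integrable fun p : ℝ × ℝ => H (p.1 + p.2 * Complex.I) := by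
      have := (hvp.integrable_comp_emb
        Complex.measurableEquivRealProd.symm.measurableEmbedding).2 hint
      simpa only [Function.comp_def, e] using this
    simp only [e] at h2
    rw [← h2, Measure.volume_eq_prod, integral_prod _ h3]
  · by_contra hcon
    refine hx ?_
    have : 1 < |x - z₀.re| := by
      by_contra h
      have := abs_le.1 (not_lt.1 h)
      exact hcon ⟨by linarith [this.1], by linarith [this.2]⟩
    simp [hre x _ this]

lemma integral_circle_eq {h : ℂ → ℂ} {z₀ : ℂ} {r : ℝ} (hr : 0 < r)
    (hh : DifferentiableOn ℂ h (Metric.closedBall z₀ r)) :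
    ∫ θ in Ioo (-Real.pi) Real.pi, h (z₀ + r * (Real.cos θ + Real.sin θ * Complex.I))
      = 2 * Real.pi * h z₀ := by
  have hd : DiffContOnCl ℂ h (Metric.ball z₀ |r|) := by
    rw [abs_of_pos hr]
    exact hh.diffContOnCl_ball subset_rfl
  have h1 := hd.circleAverage
  rw [Real.circleAverage] at h1
  have e : ∀ θ : ℝ, circleMap z₀ r θ = z₀ + r * (Real.cos θ + Real.sin θ * Complex.I) := fun θ => by
    rw [circleMap, Complex.exp_mul_I, Complex.ofReal_cos, Complex.ofReal_sin]
  have hper : Function.Periodic (fun θ => h (circleMap z₀ r θ)) (2 * Real.pi) := fun θ => by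
    simp only [periodic_circleMap z₀ r θ]
  have h2 := hper.intervalIntegral_add_eq 0 (-Real.pi)
  rw [zero_add, show -Real.pi + 2 * Real.pi = Real.pi by ring] at h2
  simp_rw [← e]
  rw [h2, intervalIntegral.integral_of_le (by linarith [Real.pi_pos]),
    integral_Ioc_eq_integral_Ioo] at h1
  rw [← h1, Complex.real_smul]
  have : (Real.pi : ℂ) ≠ 0 := Complex.ofReal_ne_zero.2 Real.pi_ne_zero
  push_cast
  field_simp

/-- In polar coordinates the weight is constant on circles about z₀, and the mean value property
replaces h there by h(z₀). -/
lemma integral_radialBump_mul_aux {h : ℂ → ℂ} {z₀ : ℂ} (hz₀ : 2 ≤ z₀.im)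
    (hh : DifferentiableOn ℂ h {z : ℂ | 0 < z.im}) :
    ∫ w, (radialBump w : ℂ) * h (z₀ + w)
      = (∫ r in Ioi (0 : ℝ), (r : ℂ) * (radialBump r * (2 * Real.pi))) * h z₀ := by
  set Φ : ℂ → ℂ := fun w => (radialBump w : ℂ) * h (z₀ + w) with hΦ
  have hΦ0 : ∀ w, 1 ≤ ‖w‖ → Φ w = 0 := fun w hw => by simp [hΦ, radialBump_eq_zero hw]
  have hΦc : Continuous Φ := by
    have h1 : Continuous fun z => (radialBump (z - z₀) : ℂ) * h z := by
      refine continuous_of_eq_zero_off_ball hz₀ ?_ fun z hz => by simp [radialBump_eq_zero hz.le]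
      exact (Complex.continuous_ofReal.comp (contDiff_radialBump.continuous.comp
        (continuous_id.sub continuous_const))).continuousOn.mul hh.continuousOn
    have h2 := h1.comp (continuous_const.add continuous_id : Continuous fun w : ℂ => z₀ + w)
    simpa [Function.comp_def, hΦ] using h2
  rw [← Complex.integral_comp_polarCoord_symm, polarCoord_target]
  simp only [Complex.polarCoord_symm_apply]
  set Ψ : ℝ × ℝ → ℂ := fun p => p.1 • Φ (p.1 * (Real.cos p.2 + Real.sin p.2 * Complex.I)) with hΨ
  have hnorm : ∀ r θ : ℝ, ‖(r : ℂ) * (Real.cos θ + Real.sin θ * Complex.I)‖ = |r| := fun r θ => by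
    rw [norm_mul, Complex.norm_real, Real.norm_eq_abs, Complex.ofReal_cos, Complex.ofReal_sin,
      ← Complex.exp_mul_I, Complex.norm_exp_ofReal_mul_I, mul_one]
  have hΨc : Continuous Ψ := by
    refine continuous_fst.smul (hΦc.comp ?_)
    fun_prop
  have hint : IntegrableOn Ψ (Ioi 0 ×ˢ Ioo (-Real.pi) Real.pi) := by
    have h1 : IntegrableOn Ψ (Icc 0 1 ×ˢ Icc (-Real.pi) Real.pi) :=
      hΨc.continuousOn.integrableOn_compact (isCompact_Icc.prod isCompact_Icc)
    refine h1.of_forall_sdiff_eq_zero (measurableSet_Ioi.prod measurableSet_Ioo) ?_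
    rintro ⟨r, θ⟩ ⟨⟨hr, hθ⟩, hn⟩
    have hr : 0 < r := hr
    have : 1 < r := by
      by_contra hcon
      exact hn ⟨⟨hr.le, not_lt.1 hcon⟩, ⟨hθ.1.le, hθ.2.le⟩⟩
    simp only [hΨ]
    rw [hΦ0 _ (by rw [hnorm, abs_of_pos hr]; exact this.le), smul_zero]
  rw [Measure.volume_eq_prod] at hint ⊢
  rw [setIntegral_prod _ hint, ← integral_mul_const]
  refine setIntegral_congr_fun measurableSet_Ioi fun r hr => ?_
  have hr : 0 < r := hr
  have hrad : ∀ θ : ℝ, radialBump ((r : ℂ) * (Real.cos θ + Real.sin θ * Complex.I))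
      = radialBump r := fun θ => by
    unfold radialBump; rw [hnorm, Complex.norm_real, Real.norm_eq_abs]
  simp only [hΨ, hΦ, hrad, Complex.real_smul, integral_const_mul]
  by_cases h1 : 1 ≤ r
  · rw [radialBump_eq_zero (w := (r : ℂ)) (by rwa [Complex.norm_real, Real.norm_of_nonneg hr.le])]
    simp
  · rw [integral_circle_eq hr (hh.mono fun z hz => ?_)]
    · ring
    · have h2 : ‖z - z₀‖ ≤ r := by simpa [dist_eq_norm] using hz
      have h3 := Complex.abs_im_le_norm (z - z₀)
      rw [Complex.sub_im] at h3
      have h4 := abs_le.1 (h3.trans h2)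
      change 0 < z.im
      linarith [h4.1]

lemma integral_radialBump_mul {h : ℂ → ℂ} {z₀ : ℂ} (hz₀ : 2 ≤ z₀.im)
    (hh : DifferentiableOn ℂ h {z : ℂ | 0 < z.im}) :
    ∫ z, (radialBump (z - z₀) : ℂ) * h z = ((∫ w, radialBump w : ℝ) : ℂ) * h z₀ := by
  have h1 := integral_radialBump_mul_aux hz₀ hh
  -- The case h = 1 identifies the radial constant as the total mass of the bump.
  have h2 := integral_radialBump_mul_aux (h := fun _ => 1) hz₀ (differentiableOn_const _)
  simp only [mul_one] at h2
  rw [← h2, integral_complex_ofReal] at h1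
  rw [← h1, ← integral_add_left_eq_self _ z₀]
  simp

lemma dbar_inv_im_pow (m : ℕ) {z : ℂ} (hz : 0 < z.im) :
    DifferentiableAt ℝ (fun w : ℂ => (((w.im)⁻¹ ^ m : ℝ) : ℂ)) z ∧
    dbar (fun w : ℂ => (((w.im)⁻¹ ^ m : ℝ) : ℂ)) z
      = Complex.I * ((m * (z.im)⁻¹ ^ (m - 1) * -(z.im ^ 2)⁻¹ : ℝ) : ℂ) := by
  have h1 : HasDerivAt (fun y : ℝ => y⁻¹ ^ m) (m * (z.im)⁻¹ ^ (m - 1) * -(z.im ^ 2)⁻¹) z.im :=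
    (hasDerivAt_inv hz.ne').fun_pow m
  have h2 : HasFDerivAt (fun w : ℂ => (((w.im)⁻¹ ^ m : ℝ) : ℂ))
      ((Complex.ofRealCLM.comp ((m * (z.im)⁻¹ ^ (m - 1) * -(z.im ^ 2)⁻¹ : ℝ) • Complex.imCLM))) z :=
    Complex.ofRealCLM.hasFDerivAt.comp z (h1.comp_hasFDerivAt z Complex.imCLM.hasFDerivAt)
  refine ⟨h2.differentiableAt, ?_⟩
  simp only [dbar, partialX, partialY, h2.fderiv]
  simp

/-- Interior estimate: if `y^{-m} conj (dbar G)` is holomorphic, its value at `z₀` is controlled by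
the size of `G` on the unit disc around `z₀`. -/
theorem exists_xi_bound (m : ℕ) : ∃ A : ℝ, ∀ (z₀ : ℂ), 2 ≤ z₀.im → ∀ (G h : ℂ → ℂ) (E : ℝ),
    ContDiffOn ℝ 1 G {z : ℂ | 0 < z.im} → DifferentiableOn ℂ h {z : ℂ | 0 < z.im} →
    (∀ z : ℂ, 0 < z.im → h z = (((z.im)⁻¹ ^ m : ℝ) : ℂ) * conj (dbar G z)) →
    (∀ z, ‖z - z₀‖ ≤ 1 → ‖G z‖ ≤ E) → ‖h z₀‖ ≤ A * E := by
  have hU : IsOpen {z : ℂ | 0 < z.im} := isOpen_lt continuous_const Complex.continuous_im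
  have hψs : ContDiff ℝ 1 (fun w => (radialBump w : ℂ)) :=
    Complex.ofRealCLM.contDiff.comp (contDiff_radialBump.of_le (by norm_cast))
  obtain ⟨L, hL⟩ := (isCompact_closedBall (0 : ℂ) 1).exists_bound_of_continuousOn
    ((continuousOn_dbar isOpen_univ hψs.contDiffOn).mono (subset_univ _))
  set cψ := ∫ w, radialBump w with hcψ
  have hc0 : 0 < cψ := integral_radialBump_pos
  -- L bounds `dbar` of the bump, m bounds `dbar` of y^{-m} where y ≥ 1, π is the area of the disc
  -- and cψ the mass of the bump.
  refine ⟨(L + m) * Real.pi / cψ, fun z₀ hz₀ G h E hG hh hhG hE => ?_⟩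
  have hball : ∀ z : ℂ, ‖z - z₀‖ ≤ 1 → 1 ≤ z.im := by
    intro z hz
    have h3 := Complex.abs_im_le_norm (z - z₀)
    rw [Complex.sub_im] at h3
    linarith [(abs_le.1 (h3.trans hz)).1]
  have hψz : ContDiff ℝ 1 (fun z => (radialBump (z - z₀) : ℂ)) :=
    hψs.comp (contDiff_id.sub contDiff_const)
  have hys : ContDiffOn ℝ 1 (fun w : ℂ => (((w.im)⁻¹ ^ m : ℝ) : ℂ)) {z : ℂ | 0 < z.im} := by
    refine Complex.ofRealCLM.contDiff.comp_contDiffOn ?_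
    exact ((Complex.imCLM.contDiff.contDiffOn).inv fun z hz => (ne_of_gt hz)).pow m
  set w : ℂ → ℂ := fun z => (radialBump (z - z₀) : ℂ) * (((z.im)⁻¹ ^ m : ℝ) : ℂ) with hw
  have hws : ContDiffOn ℝ 1 w {z : ℂ | 0 < z.im} := hψz.contDiffOn.mul hys
  have hw0 : ∀ z, 1 < ‖z - z₀‖ → w =ᶠ[𝓝 z] fun _ => 0 := fun z hz => by
    have : {w : ℂ | 1 < ‖w - z₀‖} ∈ 𝓝 z :=
      (isOpen_lt continuous_const (by fun_prop)).mem_nhds hz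
    filter_upwards [this] with v hv
    have hv : 1 < ‖v - z₀‖ := hv
    simp [hw, radialBump_eq_zero hv.le]
  have hdw0 : ∀ z, 1 < ‖z - z₀‖ → dbar w z = 0 := fun z hz => by
    rw [dbar_congr (hw0 z hz), dbar_eq_zero (differentiableAt_const _)]
  set V : ℂ → ℂ := fun z => w z * G z with hV
  have hVs : ContDiffOn ℝ 1 V {z : ℂ | 0 < z.im} := hws.mul hG
  have hV0 : ∀ z, 1 < ‖z - z₀‖ → V z = 0 := fun z hz => by
    simp [hV, (hw0 z hz).eq_of_nhds]
  have hdV0 : ∀ z, 1 < ‖z - z₀‖ → dbar V z = 0 := fun z hz => by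
    have : V =ᶠ[𝓝 z] fun _ => 0 := by
      filter_upwards [hw0 z hz] with v hv
      simp [hV, hv]
    rw [dbar_congr this, dbar_eq_zero (differentiableAt_const _)]
  -- By Green the left side has integral 0, V having compact support. By the mean value property the
  -- last term integrates to cψ conj(h z₀), which is therefore controlled by G alone, with no
  -- derivative of G.
  have hdV : ∀ z : ℂ, dbar V z = dbar w z * G z + (radialBump (z - z₀) : ℂ) * conj (h z) := by
    intro z
    by_cases hz : 1 < ‖z - z₀‖
    · rw [hdV0 z hz, hdw0 z hz, radialBump_eq_zero hz.le]; simp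
    · have hz1 : 0 < z.im := one_pos.trans_le (hball z (not_lt.1 hz))
      have hwd : DifferentiableAt ℝ w z :=
        ((hws.differentiableOn one_ne_zero) z hz1).differentiableAt (hU.mem_nhds hz1)
      have hGd : DifferentiableAt ℝ G z :=
        ((hG.differentiableOn one_ne_zero) z hz1).differentiableAt (hU.mem_nhds hz1)
      rw [dbar_mul hwd hGd, hhG z hz1, map_mul, Complex.conj_conj, Complex.conj_ofReal, ← mul_assoc]
  have hdVc : Continuous (dbar V) :=
    continuous_of_eq_zero_off_ball hz₀ (continuousOn_dbar hU hVs) hdV0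
  have hGc : Continuous fun z => dbar w z * G z :=
    continuous_of_eq_zero_off_ball hz₀ ((continuousOn_dbar hU hws).mul hG.continuousOn)
      fun z hz => by simp [hdw0 z hz]
  have hhc : Continuous fun z => (radialBump (z - z₀) : ℂ) * conj (h z) :=
    continuous_of_eq_zero_off_ball hz₀ (hψz.continuous.continuousOn.mul
      (Complex.continuous_conj.comp_continuousOn hh.continuousOn))
      fun z hz => by simp [radialBump_eq_zero hz.le]
  have hzero : ∫ z, dbar V z = 0 := by
    have hgreen := integral_rect_eq_dbar V (z₀.re - 3 / 2) (z₀.re + 3 / 2) (z₀.im - 3 / 2)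
      (z₀.im + 3 / 2) hU hVs (by
        intro z hz
        have h1 := hz.2
        rw [mem_preimage, uIcc_of_le (by linarith)] at h1
        change 0 < z.im
        linarith [h1.1])
    have him : ∀ (x y : ℝ), 1 < |y - z₀.im| → V (x + y * Complex.I) = 0 := by
      intro x y hy
      refine hV0 _ (hy.trans_le ?_)
      simpa using Complex.abs_im_le_norm (x + y * Complex.I - z₀)
    have hre : ∀ (x y : ℝ), 1 < |x - z₀.re| → V (x + y * Complex.I) = 0 := by
      intro x y hx
      refine hV0 _ (hx.trans_le ?_)
      simpa using Complex.abs_re_le_norm (x + y * Complex.I - z₀)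
    have e1 : 1 < |(z₀.im - 3 / 2) - z₀.im| := by norm_num
    have e2 : 1 < |(z₀.im + 3 / 2) - z₀.im| := by norm_num
    have e3 : 1 < |(z₀.re - 3 / 2) - z₀.re| := by norm_num
    have e4 : 1 < |(z₀.re + 3 / 2) - z₀.re| := by norm_num
    simp only [him _ _ e1, him _ _ e2, hre _ _ e3, hre _ _ e4, intervalIntegral.integral_zero,
      intervalIntegral.integral_const_mul, smul_zero, sub_zero, add_zero] at hgreen
    rw [integral_rect_eq_integral hdVc hdV0] at hgreen
    simpa using hgreen.symm
  simp only [hdV] at hzero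
  rw [integral_add (hGc.integrable_of_hasCompactSupport
      (hasCompactSupport_of_eq_zero_off_ball (z₀ := z₀) fun z hz => by simp [hdw0 z hz]))
    (hhc.integrable_of_hasCompactSupport
      (hasCompactSupport_of_eq_zero_off_ball (z₀ := z₀) fun z hz => by
        simp [radialBump_eq_zero hz.le]))] at hzero
  have hconj : ∫ z, (radialBump (z - z₀) : ℂ) * conj (h z) = conj ((cψ : ℂ) * h z₀) := by
    rw [hcψ, ← integral_radialBump_mul hz₀ hh, ← integral_conj]
    simp
  rw [hconj] at hzero
  have hnorm : cψ * ‖h z₀‖ = ‖∫ z, dbar w z * G z‖ := by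
    rw [eq_neg_of_add_eq_zero_left hzero, norm_neg, RCLike.norm_conj, norm_mul, Complex.norm_real,
      Real.norm_of_nonneg hc0.le]
  have hbound : ‖∫ z, dbar w z * G z‖ ≤ (L + m) * E * Real.pi := by
    rw [← setIntegral_eq_integral_of_forall_compl_eq_zero (s := Metric.closedBall z₀ 1)
      fun z hz => by
        rw [hdw0 z (by simpa [dist_eq_norm] using hz), zero_mul]]
    have hvol : volume.real (Metric.closedBall z₀ 1) = Real.pi := by
      simp [Measure.real, Complex.volume_closedBall]
    rw [← hvol]
    refine norm_setIntegral_le_of_norm_le_const (by simp [Complex.volume_closedBall]) fun z hz => ?_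
    have hz' : ‖z - z₀‖ ≤ 1 := by simpa [dist_eq_norm] using hz
    have hz1 := hball z hz'
    obtain ⟨hyd, hye⟩ := dbar_inv_im_pow m (one_pos.trans_le hz1)
    have hψd : DifferentiableAt ℝ (fun z => (radialBump (z - z₀) : ℂ)) z :=
      (hψz.differentiable one_ne_zero) z
    have hdψ : ‖dbar (fun z => (radialBump (z - z₀) : ℂ)) z‖ ≤ L := by
      rw [dbar_comp (φ := fun z => z - z₀) (F := fun w => (radialBump w : ℂ))
        (differentiableAt_id.sub_const z₀) ((hψs.differentiable one_ne_zero) _)]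
      have : deriv (fun z : ℂ => z - z₀) z = 1 := by simp
      rw [this, map_one, mul_one]
      exact hL _ (by simpa using hz')
    have hinv : (z.im)⁻¹ ≤ 1 := inv_le_one_of_one_le₀ hz1
    have hinv0 : 0 ≤ (z.im)⁻¹ := by positivity
    rw [norm_mul, hw, dbar_mul hψd hyd, hye]
    refine mul_le_mul ?_ (hE z hz') (norm_nonneg _) ?_
    · refine (norm_add_le _ _).trans (add_le_add ?_ ?_)
      · rw [norm_mul, Complex.norm_real, Real.norm_of_nonneg (by positivity)]
        calc _ ≤ L * 1 := mul_le_mul hdψ (pow_le_one₀ hinv0 hinv) (by positivity)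
              ((norm_nonneg _).trans hdψ)
          _ = L := mul_one L
      · rw [norm_mul, norm_mul, Complex.norm_I, one_mul, Complex.norm_real, Complex.norm_real,
          Real.norm_of_nonneg (radialBump_nonneg _), norm_mul, norm_mul, norm_neg,
          Real.norm_of_nonneg (Nat.cast_nonneg m), Real.norm_of_nonneg (by positivity),
          Real.norm_of_nonneg (by positivity), ← inv_pow]
        calc radialBump (z - z₀) * (m * (z.im)⁻¹ ^ (m - 1) * (z.im)⁻¹ ^ 2)
            ≤ 1 * (m * 1 * 1) := by
              gcongr
              · exact radialBump_le_one _
              · exact pow_le_one₀ hinv0 hinv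
              · exact pow_le_one₀ hinv0 hinv
          _ = m := by ring
    · have := (norm_nonneg _).trans hdψ
      positivity
  rw [div_mul_eq_mul_div, le_div_iff₀ hc0, mul_comm _ cψ, hnorm]
  linarith

/-! ### Boundedness of the invariant norm of `ξ f` -/

/-- The `Γ`-invariant norm `y^{1-m/2} |(∂_x + i ∂_y) F|` in weight `-m`. -/
noncomputable def xiNorm (m : ℕ) (F : ℂ → ℂ) (z : ℂ) : ℝ := z.im / √z.im ^ m * ‖dbar F z‖

lemma xiNorm_congr (m : ℕ) {F G : ℂ → ℂ} {z : ℂ} (h : F =ᶠ[𝓝 z] G) :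
    xiNorm m F z = xiNorm m G z := by
  rw [xiNorm, xiNorm, dbar_congr h]

/-- Common form of the invariance: Im scales by s², |φ'| = s² and |u| = s^{-m}. It serves Möbius
maps with s = 1/|cz+d| and the Fricke involution with s = 1/(√N |z|). -/
lemma xiNorm_mul_comp (m : ℕ) {u φ F : ℂ → ℂ} {z : ℂ} {s : ℝ} (hs : 0 < s)
    (hu : DifferentiableAt ℂ u z) (hφ : DifferentiableAt ℂ φ z)
    (hF : DifferentiableAt ℝ F (φ z)) (hz : 0 < z.im) (him : (φ z).im = z.im * s ^ 2)
    (hd : ‖deriv φ z‖ = s ^ 2) (hus : ‖u z‖ * s ^ m = 1) :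
    xiNorm m (fun w => u w * F (φ w)) z = xiNorm m F (φ z) := by
  have hy : 0 < √z.im := Real.sqrt_pos.2 hz
  have hu' : ‖u z‖ = (s ^ m)⁻¹ := eq_inv_of_mul_eq_one_left hus
  rw [xiNorm, xiNorm, dbar_mul_comp hu hφ hF, norm_mul, norm_mul, RCLike.norm_conj, hd, him,
    Real.sqrt_mul hz.le, Real.sqrt_sq hs.le, hu', mul_pow]
  field_simp

lemma continuousOn_xiNorm (m : ℕ) {F : ℂ → ℂ} (hF : ContDiffOn ℝ 1 F {z : ℂ | 0 < z.im}) :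
    ContinuousOn (xiNorm m F) {z : ℂ | 0 < z.im} := by
  have hU : IsOpen {z : ℂ | 0 < z.im} := isOpen_lt continuous_const Complex.continuous_im
  refine ContinuousOn.mul (ContinuousOn.div Complex.continuous_im.continuousOn
    ((Real.continuous_sqrt.comp Complex.continuous_im).pow m).continuousOn fun z hz => ?_)
    (continuousOn_dbar hU hF).norm
  exact pow_ne_zero _ (Real.sqrt_pos.2 hz).ne'

/-! ### Behaviour under real Möbius maps of determinant one. -/

section Moebius

variable {a b c d : ℝ} {z : ℂ}

lemma denom_ne_zero_of_det (hdet : a * d - b * c = 1) (hz : 0 < z.im) : (c : ℂ) * z + d ≠ 0 := by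
  intro h
  have h1 := congrArg Complex.im h
  have h2 := congrArg Complex.re h
  simp at h1 h2
  rcases h1 with h1 | h1
  · rw [h1] at h2 hdet
    simp at h2
    rw [h2] at hdet
    simp at hdet
  · exact hz.ne' h1

lemma moebius_im (hdet : a * d - b * c = 1) :
    (((a : ℂ) * z + b) / ((c : ℂ) * z + d)).im = z.im * (‖(c : ℂ) * z + d‖⁻¹) ^ 2 := by
  rw [Complex.div_im, inv_pow, ← Complex.normSq_eq_norm_sq]
  simp
  rw [← sub_div, div_eq_mul_inv]
  congr 1
  linear_combination z.im * hdet

lemma hasDerivAt_moebius (hdet : a * d - b * c = 1) (hz : 0 < z.im) :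
    HasDerivAt (fun w : ℂ => ((a : ℂ) * w + b) / ((c : ℂ) * w + d))
      (((c : ℂ) * z + d)⁻¹ ^ 2) z := by
  have h0 := denom_ne_zero_of_det hdet hz
  have h1 : HasDerivAt (fun w : ℂ => (a : ℂ) * w + b) a z := by
    simpa using ((hasDerivAt_id z).const_mul (a : ℂ)).add_const (b : ℂ)
  have h2 : HasDerivAt (fun w : ℂ => (c : ℂ) * w + d) c z := by
    simpa using ((hasDerivAt_id z).const_mul (c : ℂ)).add_const (d : ℂ)
  refine (h1.div h2 h0).congr_deriv ?_
  have hdet' : (a : ℂ) * d - b * c = 1 := by exact_mod_cast hdet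
  field_simp
  linear_combination hdet'

lemma differentiableAt_moebius_factor (m : ℕ) :
    DifferentiableAt ℂ (fun w : ℂ => ((c : ℂ) * w + d) ^ m) z := by fun_prop

lemma moebius_mem (hdet : a * d - b * c = 1) (hz : 0 < z.im) :
    0 < (((a : ℂ) * z + b) / ((c : ℂ) * z + d)).im := by
  have h := norm_pos_iff.2 (denom_ne_zero_of_det hdet hz)
  rw [moebius_im hdet]
  positivity

lemma xiNorm_moebius (m : ℕ) {F : ℂ → ℂ} (hF : DifferentiableOn ℝ F {z : ℂ | 0 < z.im})
    (hdet : a * d - b * c = 1) (hz : 0 < z.im) :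
    xiNorm m (fun w => ((c : ℂ) * w + d) ^ m * F (((a : ℂ) * w + b) / ((c : ℂ) * w + d))) z
      = xiNorm m F (((a : ℂ) * z + b) / ((c : ℂ) * z + d)) := by
  have hU : IsOpen {z : ℂ | 0 < z.im} := isOpen_lt continuous_const Complex.continuous_im
  have h := norm_pos_iff.2 (denom_ne_zero_of_det hdet hz)
  refine xiNorm_mul_comp m (s := ‖(c : ℂ) * z + d‖⁻¹) (by positivity)
    (differentiableAt_moebius_factor m) (hasDerivAt_moebius hdet hz).differentiableAt
    ((hF _ (moebius_mem hdet hz)).differentiableAt (hU.mem_nhds (moebius_mem hdet hz))) hz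
    (moebius_im hdet) ?_ ?_
  · rw [(hasDerivAt_moebius hdet hz).deriv, norm_pow, norm_inv]
  · rw [norm_pow, ← mul_pow, mul_inv_cancel₀ h.ne', one_pow]

lemma contDiffOn_moebius (m : ℕ) {F : ℂ → ℂ} (hF : ContDiffOn ℝ 1 F {z : ℂ | 0 < z.im})
    (hdet : a * d - b * c = 1) :
    ContDiffOn ℝ 1 (fun w => ((c : ℂ) * w + d) ^ m * F (((a : ℂ) * w + b) / ((c : ℂ) * w + d)))
      {z : ℂ | 0 < z.im} := by
  have hφ : ContDiffOn ℂ 1 (fun w : ℂ => ((a : ℂ) * w + b) / ((c : ℂ) * w + d))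
      {z : ℂ | 0 < z.im} :=
    ContDiffOn.div (by fun_prop) (by fun_prop) fun z hz => denom_ne_zero_of_det hdet hz
  exact ContDiffOn.mul (by fun_prop)
    (hF.comp (hφ.restrict_scalars ℝ) fun z hz => moebius_mem hdet hz)

/-- The function y^{-m} conj(`dbar F`) transforms with weight m + 2: passing to F|σ composes it with
σ and multiplies it by (cz+d)^{-(m+2)}, which preserves holomorphy. -/
lemma differentiableOn_xi_moebius (m : ℕ) {F : ℂ → ℂ}
    (hF : DifferentiableOn ℝ F {z : ℂ | 0 < z.im})
    (hh : DifferentiableOn ℂ (fun z => (((z.im)⁻¹ ^ m : ℝ) : ℂ) * conj (dbar F z))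
      {z : ℂ | 0 < z.im}) (hdet : a * d - b * c = 1) :
    DifferentiableOn ℂ (fun z => (((z.im)⁻¹ ^ m : ℝ) : ℂ) * conj (dbar (fun w =>
      ((c : ℂ) * w + d) ^ m * F (((a : ℂ) * w + b) / ((c : ℂ) * w + d))) z))
      {z : ℂ | 0 < z.im} := by
  have hU : IsOpen {z : ℂ | 0 < z.im} := isOpen_lt continuous_const Complex.continuous_im
  have hφ : DifferentiableOn ℂ (fun w : ℂ => ((a : ℂ) * w + b) / ((c : ℂ) * w + d))
      {z : ℂ | 0 < z.im} := fun z hz =>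
    (hasDerivAt_moebius hdet hz).differentiableAt.differentiableWithinAt
  have h1 : DifferentiableOn ℂ (fun z : ℂ => (((c : ℂ) * z + d)⁻¹) ^ (m + 2) *
      (fun z => (((z.im)⁻¹ ^ m : ℝ) : ℂ) * conj (dbar F z)) (((a : ℂ) * z + b) / ((c : ℂ) * z + d)))
      {z : ℂ | 0 < z.im} := by
    refine DifferentiableOn.mul (DifferentiableOn.pow (DifferentiableOn.inv (by fun_prop)
      fun z hz => denom_ne_zero_of_det hdet hz) _) (hh.comp hφ fun z hz => moebius_mem hdet hz)
  refine h1.congr fun z hz => ?_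
  have hz : 0 < z.im := hz
  have h0 := denom_ne_zero_of_det hdet hz
  rw [dbar_mul_comp (differentiableAt_moebius_factor m)
    (hasDerivAt_moebius hdet hz).differentiableAt
    ((hF _ (moebius_mem hdet hz)).differentiableAt (hU.mem_nhds (moebius_mem hdet hz))),
    (hasDerivAt_moebius hdet hz).deriv]
  simp only [moebius_im hdet]
  set j : ℂ := (c : ℂ) * z + d
  have hn : ((‖j‖ : ℝ) : ℂ) ^ 2 = j * conj j := by
    rw [Complex.mul_conj, Complex.normSq_eq_norm_sq]; push_cast; rfl
  have hj' : conj j ≠ 0 := (map_ne_zero _).2 h0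
  have hnn : ((‖j‖ : ℝ) : ℂ) ≠ 0 := Complex.ofReal_ne_zero.2 (norm_ne_zero_iff.2 h0)
  have hy : (z.im : ℂ) ≠ 0 := Complex.ofReal_ne_zero.2 hz.ne'
  have e : (((z.im * ‖j‖⁻¹ ^ 2)⁻¹ ^ m : ℝ) : ℂ) = (z.im : ℂ)⁻¹ ^ m * (j * conj j) ^ m := by
    rw [← hn, ← mul_pow]; push_cast; congr 1
    field_simp
  rw [e]
  simp only [map_mul, map_pow, map_inv₀, Complex.conj_conj]
  push_cast
  rw [mul_pow, pow_add, inv_pow j m]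
  field_simp

end Moebius

lemma slashPlain_neg_natCast (m : ℕ) (f : ℍ → ℂ) (σ : SL(2, ℤ)) (z : ℍ) :
    slashPlain (-(m : ℝ)) f σ z
      = ((((σ 1 0 : ℤ) : ℝ) : ℂ) * z + (((σ 1 1 : ℤ) : ℝ) : ℂ)) ^ m * (f ∘ ofComplex)
        (((((σ 0 0 : ℤ) : ℝ) : ℂ) * z + (((σ 0 1 : ℤ) : ℝ) : ℂ)) /
        ((((σ 1 0 : ℤ) : ℝ) : ℂ) * z + (((σ 1 1 : ℤ) : ℝ) : ℂ))) := by
  have h := coe_specialLinearGroup_apply σ z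
  simp only [algebraMap_int_eq, eq_intCast] at h
  rw [← h, Function.comp_apply, ofComplex_apply, slashPlain]
  simp

lemma det_real (σ : SL(2, ℤ)) :
    ((σ 0 0 : ℤ) : ℝ) * ((σ 1 1 : ℤ) : ℝ) - ((σ 0 1 : ℤ) : ℝ) * ((σ 1 0 : ℤ) : ℝ) = 1 := by
  have := σ.det_coe
  rw [Matrix.det_fin_two] at this
  exact_mod_cast this

lemma exists_pow_mul_exp_neg_le (p : ℕ) {ε : ℝ} (hε : 0 < ε) :
    ∃ C : ℝ, ∀ y : ℝ, 0 ≤ y → y ^ p * Real.exp (-ε * y) ≤ C := by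
  refine ⟨p.factorial / ε ^ p, fun y hy => ?_⟩
  have h1 := Real.pow_div_factorial_le_exp (ε * y) (by positivity) p
  rw [neg_mul, Real.exp_neg, ← div_eq_mul_inv, div_le_iff₀ (Real.exp_pos _)]
  calc y ^ p = p.factorial / ε ^ p * ((ε * y) ^ p / p.factorial) := by
        rw [mul_pow]; field_simp
    _ ≤ _ := by gcongr

/-! ### The invariant norm at the cusps, on ℍ, and after the Fricke involution. -/

section CuspBounds

variable {N : ℕ} {χ : DirichletCharacter ℂ N} {m : ℕ} {f : ℍ → ℂ}

/-- Subtracting the polynomial in e^{-2πiz/M} does not change `dbar`, so the interior estimate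
applies to the exponentially small difference; the decay then absorbs the power y^{1+m}. -/
lemma xiNorm_smul_isBigO (hf : IsHarmonicMaassForm (-(m : ℝ)) N χ f) (σ : SL(2, ℤ)) :
    (fun τ : ℍ => xiNorm m (f ∘ ofComplex) ((σ • τ : ℍ) : ℂ)) =O[atImInfty]
      fun τ : ℍ => τ.im ^ (0 : ℝ) := by
  have hU : IsOpen {z : ℂ | 0 < z.im} := isOpen_lt continuous_const Complex.continuous_im
  set F := f ∘ ofComplex with hF
  have hF1 : ContDiffOn ℝ 1 F {z : ℂ | 0 < z.im} := hf.smooth.of_le (by norm_cast)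
  have hFd := hF1.differentiableOn one_ne_zero
  have hdet := det_real σ
  set Fσ : ℂ → ℂ := fun z =>
    ((((σ 1 0 : ℤ) : ℝ) : ℂ) * z + (((σ 1 1 : ℤ) : ℝ) : ℂ)) ^ m * F
        (((((σ 0 0 : ℤ) : ℝ) : ℂ) * z + (((σ 0 1 : ℤ) : ℝ) : ℂ)) /
        ((((σ 1 0 : ℤ) : ℝ) : ℂ) * z + (((σ 1 1 : ℤ) : ℝ) : ℂ))) with hFσ
  have hFσ1 : ContDiffOn ℝ 1 Fσ {z : ℂ | 0 < z.im} := contDiffOn_moebius m hF1 hdet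
  have hxi := differentiableOn_xi m hf.smooth (fun z hz => by
    have := hf.laplacian_eq_zero ⟨z, hz⟩
    exact this)
  have hxiσ := differentiableOn_xi_moebius m hFd hxi hdet
  obtain ⟨A, hA⟩ := exists_xi_bound m
  obtain ⟨M, P, ε, -, hε, hO⟩ := hf.cusps σ
  obtain ⟨C, hC⟩ := hO.bound
  rw [Filter.Eventually, atImInfty_mem] at hC
  obtain ⟨Y, hY⟩ := hC
  obtain ⟨C₁, hC₁⟩ := exists_pow_mul_exp_neg_le (1 + m) hε
  set Pz : ℂ → ℂ := fun z => P.eval (Complex.exp (-(2 * Real.pi * Complex.I * z / (M : ℂ)))) with hPz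
  have hPd : ContDiff ℂ 1 Pz := by
    have h1 : ContDiff ℂ 1 (fun w : ℂ => P.eval w) := by
      simpa using P.contDiff_aeval (𝕜 := ℂ) 1
    exact h1.comp (by fun_prop)
  set G : ℂ → ℂ := fun z => Fσ z - Pz z with hG
  have hG1 : ContDiffOn ℝ 1 G {z : ℂ | 0 < z.im} := hFσ1.sub (hPd.restrict_scalars ℝ).contDiffOn
  have hdG : ∀ z : ℂ, 0 < z.im → dbar G z = dbar Fσ z := by
    intro z hz
    have hPc : DifferentiableAt ℂ Pz z := hPd.differentiable one_ne_zero z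
    rw [hG, dbar_sub ((hFσ1.differentiableOn one_ne_zero _ hz).differentiableAt (hU.mem_nhds hz))
      (hPc.restrictScalars ℝ), dbar_eq_zero hPc, sub_zero]
  simp only [Real.rpow_zero]
  refine IsBigO.of_bound (A * (C * Real.exp ε) * C₁) ?_
  rw [Filter.Eventually, atImInfty_mem]
  -- The 2 is required by the interior estimate; Y + 1 keeps the unit disc about τ where the cusp
  -- expansion is valid.
  refine ⟨max 2 (Y + 1), fun τ hτ => ?_⟩
  have h2 : 2 ≤ (τ : ℂ).im := (le_max_left _ _).trans hτ
  have hYτ : Y + 1 ≤ (τ : ℂ).im := (le_max_right _ _).trans hτ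
  have hτ0 : 0 < (τ : ℂ).im := τ.im_pos
  have hsm : ((σ • τ : ℍ) : ℂ) = (((((σ 0 0 : ℤ) : ℝ) : ℂ) * τ + (((σ 0 1 : ℤ) : ℝ) : ℂ)) /
        ((((σ 1 0 : ℤ) : ℝ) : ℂ) * τ + (((σ 1 1 : ℤ) : ℝ) : ℂ))) := by
    have h := coe_specialLinearGroup_apply σ τ
    simpa only [algebraMap_int_eq, eq_intCast] using h
  -- The factor e^ε pays for Im z ≥ Im τ - 1 on the disc.
  have hGb : ∀ z : ℂ, ‖z - τ‖ ≤ 1 → ‖G z‖ ≤ C * Real.exp ε * Real.exp (-ε * (τ : ℂ).im) := by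
    intro z hz
    have h3 := (abs_le.1 ((Complex.abs_im_le_norm (z - τ)).trans hz)).1
    rw [Complex.sub_im] at h3
    have hz0 : 0 < z.im := by linarith
    have h4 : ‖slashPlain (-(m : ℝ)) f σ ⟨z, hz0⟩ - Pz z‖
      ≤ C * ‖Real.exp (-ε * z.im)‖ := hY ⟨z, hz0⟩ (show Y ≤ z.im by linarith)
    rw [slashPlain_neg_natCast] at h4
    have hC0 : 0 ≤ C := by
      have := (norm_nonneg _).trans h4
      exact nonneg_of_mul_nonneg_left this (norm_pos_iff.2 (Real.exp_pos _).ne')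
    refine h4.trans ?_
    rw [Real.norm_of_nonneg (Real.exp_pos _).le, mul_assoc, ← Real.exp_add]
    refine mul_le_mul_of_nonneg_left (Real.exp_le_exp.2 ?_) hC0
    nlinarith
  have hb := hA τ h2 G _ _ hG1 hxiσ (fun z hz => by rw [hdG z hz]) hGb
  have hdb : ‖dbar Fσ τ‖ = (τ : ℂ).im ^ m * ‖((((τ : ℂ).im)⁻¹ ^ m : ℝ) : ℂ) * conj (dbar Fσ τ)‖ := by
    rw [norm_mul, Complex.norm_real, RCLike.norm_conj, Real.norm_of_nonneg (by positivity), inv_pow,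
      mul_inv_cancel_left₀ (by positivity)]
  change ‖xiNorm m F ((σ • τ : ℍ) : ℂ)‖ ≤ _
  rw [hsm, ← xiNorm_moebius m hFd hdet hτ0]
  change ‖xiNorm m Fσ τ‖ ≤ _
  have h1s : 1 ≤ √(τ : ℂ).im := Real.one_le_sqrt.2 (by linarith)
  have hx0 : 0 ≤ xiNorm m Fσ τ := by unfold xiNorm; positivity
  have hB0 : 0 ≤ A * (C * Real.exp ε * Real.exp (-ε * (τ : ℂ).im)) := (norm_nonneg _).trans hb
  have hAC : 0 ≤ A * (C * Real.exp ε) := by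
    rw [← mul_assoc] at hB0
    exact nonneg_of_mul_nonneg_left hB0 (Real.exp_pos _)
  rw [Real.norm_of_nonneg hx0, norm_one, mul_one, xiNorm, hdb]
  calc (τ : ℂ).im / √(τ : ℂ).im ^ m * ((τ : ℂ).im ^ m *
        ‖((((τ : ℂ).im)⁻¹ ^ m : ℝ) : ℂ) * conj (dbar Fσ τ)‖)
      ≤ (τ : ℂ).im / 1 * ((τ : ℂ).im ^ m * (A * (C * Real.exp ε * Real.exp (-ε * (τ : ℂ).im)))) := by
        gcongr
        exact one_le_pow₀ h1s
    _ = A * (C * Real.exp ε) * ((τ : ℂ).im ^ (1 + m) * Real.exp (-ε * (τ : ℂ).im)) := by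
        rw [pow_add]; ring
    _ ≤ _ := mul_le_mul_of_nonneg_left (hC₁ _ hτ0.le) hAC

/-- From |χ| ≤ 1 only an inequality results; applying it to γ⁻¹ as well yields invariance. -/
lemma xiNorm_smul_le (hf : IsHarmonicMaassForm (-(m : ℝ)) N χ f) {γ : SL(2, ℤ)}
    (hγ : γ ∈ CongruenceSubgroup.Gamma0 N) (τ : ℍ) :
    xiNorm m (f ∘ ofComplex) ((γ • τ : ℍ) : ℂ) ≤ xiNorm m (f ∘ ofComplex) τ := by
  have hU : IsOpen {z : ℂ | 0 < z.im} := isOpen_lt continuous_const Complex.continuous_im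
  have hF1 : ContDiffOn ℝ 1 (f ∘ ofComplex) {z : ℂ | 0 < z.im} := hf.smooth.of_le (by norm_cast)
  have hFd := hF1.differentiableOn one_ne_zero
  have hτ0 : 0 < (τ : ℂ).im := τ.im_pos
  have hsm : ((γ • τ : ℍ) : ℂ) = (((((γ 0 0 : ℤ) : ℝ) : ℂ) * τ + (((γ 0 1 : ℤ) : ℝ) : ℂ)) /
        ((((γ 1 0 : ℤ) : ℝ) : ℂ) * τ + (((γ 1 1 : ℤ) : ℝ) : ℂ))) := by
    have h := coe_specialLinearGroup_apply γ τ
    simpa only [algebraMap_int_eq, eq_intCast] using h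
  rw [hsm, ← xiNorm_moebius m hFd (det_real γ) hτ0]
  set x : ℂ := χ ((γ 1 1 : ℤ) : ZMod N)
  have hx : ‖x‖ ≤ 1 := χ.norm_le_one _
  rw [xiNorm_congr m (G := fun w => x * (f ∘ ofComplex) w)]
  · rw [xiNorm, dbar_const_mul x ((hFd _ hτ0).differentiableAt (hU.mem_nhds hτ0)), norm_mul, xiNorm]
    have : ‖x‖ * ‖dbar (f ∘ ofComplex) τ‖ ≤ ‖dbar (f ∘ ofComplex) τ‖ :=
      mul_le_of_le_one_left (norm_nonneg _) hx
    exact mul_le_mul_of_nonneg_left this (by positivity)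
  · filter_upwards [hU.mem_nhds hτ0] with w hw
    have h := hf.slash_eq γ hγ ⟨w, hw⟩
    rw [slashHalf, if_pos ⟨-(m : ℤ), by simp⟩, one_mul, slashPlain_neg_natCast] at h
    have h' : (f ∘ ofComplex) w = f ⟨w, hw⟩ := by
      rw [Function.comp_apply, ofComplex_apply_of_im_pos hw]
    rw [h']
    exact h

/-- A continuous Γ₀(N)-invariant function that is O(1) at every cusp is bounded. -/
theorem exists_xiNorm_bound [NeZero N] (hf : IsHarmonicMaassForm (-(m : ℝ)) N χ f) :
    ∃ K, ∀ z : ℂ, 0 < z.im → xiNorm m (f ∘ ofComplex) z ≤ K := by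
  have hF1 : ContDiffOn ℝ 1 (f ∘ ofComplex) {z : ℂ | 0 < z.im} := hf.smooth.of_le (by norm_cast)
  have hcont : Continuous fun τ : ℍ => xiNorm m (f ∘ ofComplex) τ :=
    (continuousOn_xiNorm m hF1).comp_continuous continuous_coe fun τ => τ.im_pos
  obtain ⟨K, hK⟩ := ModularGroup.exists_bound_of_subgroup_invariant_of_isBigO hcont le_rfl
    (fun σ => xiNorm_smul_isBigO hf σ) (Γ := CongruenceSubgroup.Gamma0 N) (fun γ hγ τ => by
      refine le_antisymm (xiNorm_smul_le hf hγ τ) ?_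
      have := xiNorm_smul_le hf (inv_mem hγ) (γ • τ)
      rwa [inv_smul_smul] at this)
  refine ⟨K, fun z hz => ?_⟩
  have := hK ⟨z, hz⟩
  rw [Real.rpow_zero, mul_one] at this
  exact (le_abs_self _).trans this

lemma frickeSlash_comp_ofComplex [NeZero N] (m : ℕ) (f : ℍ → ℂ) {z : ℂ} (hz : 0 < z.im) :
    (frickeSlash (-(m : ℝ)) N f ∘ ofComplex) z = ((((N : ℝ) ^ (-(m : ℝ) / 2) : ℝ) : ℂ) *
      ((N : ℂ) * z) ^ m) * (f ∘ ofComplex) (-1 / ((N : ℂ) * z)) := by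
  have him := fricke_im_pos N ⟨z, hz⟩
  rw [Function.comp_apply, ofComplex_apply_of_im_pos hz, frickeSlash, Function.comp_apply,
    ofComplex_apply_of_im_pos him]
  simp

/-- Carrying the bound over to g directly avoids having to show that g is itself a harmonic Maass
form. -/
theorem fricke_contDiffOn_and_xiNorm [NeZero N] {K : ℝ}
    (hF1 : ContDiffOn ℝ 1 (f ∘ ofComplex) {z : ℂ | 0 < z.im})
    (hK : ∀ z : ℂ, 0 < z.im → xiNorm m (f ∘ ofComplex) z ≤ K) :
    ContDiffOn ℝ 1 (frickeSlash (-(m : ℝ)) N f ∘ ofComplex) {z : ℂ | 0 < z.im} ∧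
    ∀ z : ℂ, 0 < z.im → xiNorm m (frickeSlash (-(m : ℝ)) N f ∘ ofComplex) z ≤ K := by
  have hU : IsOpen {z : ℂ | 0 < z.im} := isOpen_lt continuous_const Complex.continuous_im
  have hN := sqrt_natCast_pos N
  have hN0 : (N : ℂ) ≠ 0 := Nat.cast_ne_zero.2 (NeZero.ne N)
  have hz0 : ∀ z : ℂ, 0 < z.im → z ≠ 0 := fun z hz h => by simp [h] at hz
  have hNz : ∀ z : ℂ, 0 < z.im → (N : ℂ) * z ≠ 0 := fun z hz => mul_ne_zero hN0 (hz0 z hz)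
  constructor
  · have hφ : ContDiffOn ℂ 1 (fun w : ℂ => -1 / ((N : ℂ) * w)) {z : ℂ | 0 < z.im} :=
      ContDiffOn.div (by fun_prop) (by fun_prop) hNz
    exact ContDiffOn.congr (f₁ := frickeSlash (-(m : ℝ)) N f ∘ ofComplex)
      (ContDiffOn.mul (by fun_prop) (hF1.comp (hφ.restrict_scalars ℝ)
        fun z hz => fricke_im_pos N ⟨z, hz⟩))
      fun z hz => frickeSlash_comp_ofComplex m f hz
  · intro z hz
    have hev : frickeSlash (-(m : ℝ)) N f ∘ ofComplex =ᶠ[𝓝 z] fun w =>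
        ((((N : ℝ) ^ (-(m : ℝ) / 2) : ℝ) : ℂ) *
      ((N : ℂ) * w) ^ m) * (f ∘ ofComplex) (-1 / ((N : ℂ) * w)) := by
      filter_upwards [hU.mem_nhds hz] with w hw using frickeSlash_comp_ofComplex m f hw
    have him : 0 < (-1 / ((N : ℂ) * z)).im := fricke_im_pos N ⟨z, hz⟩
    have hnz : 0 < ‖z‖ := norm_pos_iff.2 (hz0 z hz)
    have hNN : √(N : ℝ) ^ 2 = N := Real.sq_sqrt (Nat.cast_nonneg N)
    have hder : HasDerivAt (fun w : ℂ => -1 / ((N : ℂ) * w)) (1 / ((N : ℂ) * z ^ 2)) z := by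
      have h1 : HasDerivAt (fun w : ℂ => (N : ℂ) * w) N z := by
        simpa using (hasDerivAt_id z).const_mul (N : ℂ)
      refine ((hasDerivAt_const z (-1 : ℂ)).div h1 (hNz z hz)).congr_deriv ?_
      have := hz0 z hz
      field_simp
      ring
    rw [xiNorm_congr m hev, xiNorm_mul_comp m (s := (√(N : ℝ) * ‖z‖)⁻¹) (by positivity)
      (by fun_prop) hder.differentiableAt
      ((hF1.differentiableOn one_ne_zero _ him).differentiableAt (hU.mem_nhds him)) hz]
    · exact hK _ him
    · rw [Complex.div_im, inv_pow, mul_pow, hNN, ← Complex.normSq_eq_norm_sq]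
      have : Complex.normSq z ≠ 0 := (Complex.normSq_pos.2 (hz0 z hz)).ne'
      simp
      field_simp
    · rw [hder.deriv, norm_div, norm_mul, norm_pow, inv_pow, mul_pow, hNN]
      simp
    · rw [norm_mul, norm_pow, norm_mul, Complex.norm_real,
        Real.norm_of_nonneg (by positivity), Complex.norm_natCast, neg_div,
        Real.rpow_neg (Nat.cast_nonneg N), Real.rpow_div_two_eq_sqrt _ (Nat.cast_nonneg N),
        Real.rpow_natCast, ← inv_pow, ← mul_pow, ← mul_pow]
      nth_rewrite 2 [← hNN]
      rw [show (√(N : ℝ))⁻¹ * (√(N : ℝ) ^ 2 * ‖z‖) * (√(N : ℝ) * ‖z‖)⁻¹ = 1 by field_simp, one_pow]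

end CuspBounds

/-! ### Boundedness of the coefficients `c⁻(n)` -/

/-- `e^{2πinz}` on the whole complex plane. -/
noncomputable def expPow (n : ℤ) (z : ℂ) : ℂ := Complex.exp (2 * Real.pi * Complex.I * (n : ℂ) * z)

lemma differentiable_expPow (n : ℤ) : Differentiable ℂ (expPow n) := by
  unfold expPow; fun_prop

lemma norm_expPow (n : ℤ) (z : ℂ) : ‖expPow n z‖ = Real.exp (-(2 * Real.pi * n * z.im)) := by
  rw [expPow, Complex.norm_exp]
  congr 1
  simp [Complex.mul_re, Complex.mul_im]

lemma expPow_add (m n : ℤ) (z : ℂ) : expPow m z * expPow n z = expPow (m + n) z := by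
  simp only [expPow, ← Complex.exp_add]
  congr 1; push_cast; ring

lemma expPow_add_one (n : ℤ) (z : ℂ) : expPow n (1 + z) = expPow n z := by
  simp only [expPow]
  rw [show 2 * Real.pi * Complex.I * (n : ℂ) * (1 + z)
    = 2 * Real.pi * Complex.I * (n : ℂ) * z + n * (2 * Real.pi * Complex.I) by ring,
    Complex.exp_add, Complex.exp_int_mul_two_pi_mul_I, mul_one]

lemma integral_expPow (n : ℤ) (y : ℝ) :
    ∫ x : ℝ in (0 : ℝ)..1, expPow n (x + y * Complex.I) = if n = 0 then 1 else 0 := by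
  split_ifs with h
  · simp [h, expPow]
  · have hn : (2 * Real.pi * Complex.I * n : ℂ) ≠ 0 := by
      simp [Real.pi_ne_zero, h]
    have e : ∀ x : ℝ, expPow n (x + y * Complex.I)
        = Complex.exp (2 * Real.pi * Complex.I * n * x) * expPow n (y * Complex.I) := fun x => by
      rw [expPow, expPow, ← Complex.exp_add]; ring_nf
    simp_rw [e]
    rw [intervalIntegral.integral_mul_const, integral_exp_mul_complex hn]
    have : Complex.exp (2 * Real.pi * Complex.I * n * ((1 : ℝ) : ℂ)) = 1 := by
      rw [show 2 * Real.pi * Complex.I * n * ((1 : ℝ) : ℂ) = n * (2 * Real.pi * Complex.I) by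
        push_cast; ring]
      exact Complex.exp_int_mul_two_pi_mul_I n
    rw [this]; simp

/-- On a horizontal line |q^j| is constant, so absolute convergence at one point is uniform there,
and orthogonality of exponentials applies term by term. -/
lemma integral_tsum_expPow {ι : Type*} [Countable ι] (a : ι → ℂ) (j : ι → ℤ) (n : ℤ) (y : ℝ)
    (hs : Summable fun i => a i * expPow (j i) (y * Complex.I)) :
    Continuous (fun x : ℝ => (∑' i, a i * expPow (j i) (x + y * Complex.I)) *
      expPow n (x + y * Complex.I)) ∧
    ∫ x : ℝ in (0 : ℝ)..1, (∑' i, a i * expPow (j i) (x + y * Complex.I)) *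
      expPow n (x + y * Complex.I) = ∑' i, a i * (if j i + n = 0 then 1 else 0) := by
  have hcont : ∀ k : ℤ, Continuous fun x : ℝ => expPow k (x + y * Complex.I) := fun k =>
    (differentiable_expPow k).continuous.comp (by fun_prop)
  have hnorm : ∀ (k : ℤ) (x : ℝ), ‖expPow k (x + y * Complex.I)‖ = ‖expPow k (y * Complex.I)‖ := by
    intro k x
    simp [norm_expPow]
  have hterm : ∀ i (x : ℝ), ‖a i * expPow (j i) (x + y * Complex.I)‖
      ≤ ‖a i * expPow (j i) (y * Complex.I)‖ := fun i x => by
    rw [norm_mul, norm_mul, hnorm]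
  refine ⟨(continuous_tsum (fun i => continuous_const.mul (hcont (j i))) hs.norm hterm).mul
    (hcont n), ?_⟩
  have h := intervalIntegral.hasSum_integral_of_dominated_convergence (μ := volume)
    (a := (0 : ℝ)) (b := 1)
    (F := fun i (x : ℝ) => a i * expPow (j i) (x + y * Complex.I) * expPow n (x + y * Complex.I))
    (f := fun x : ℝ => (∑' i, a i * expPow (j i) (x + y * Complex.I)) *
      expPow n (x + y * Complex.I))
    (fun i _ => ‖a i * expPow (j i) (y * Complex.I)‖ * ‖expPow n (y * Complex.I)‖)
    (fun i => ((continuous_const.mul (hcont (j i))).mul (hcont n)).aestronglyMeasurable)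
    (fun i => Eventually.of_forall fun x _ => by
      rw [norm_mul, hnorm n]
      exact mul_le_mul_of_nonneg_right (hterm i x) (norm_nonneg _))
    (Eventually.of_forall fun x _ => hs.norm.mul_right _)
    (by simp)
    (Eventually.of_forall fun x _ =>
      (Summable.of_norm_bounded hs.norm (fun i => hterm i x)).hasSum.mul_right _)
  rw [← h.tsum_eq]
  refine tsum_congr fun i => ?_
  simp only [mul_assoc, expPow_add]
  rw [intervalIntegral.integral_const_mul, integral_expPow]

/-- Needed to divide by the factor of c⁻(n) that remains after subtracting Fourier integrals at two
heights. -/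
lemma upperGamma_sub_pos (m : ℕ) {a b : ℝ} (ha : 0 < a) (hab : a < b) :
    0 < upperGamma (m + 1) a - upperGamma (m + 1) b := by
  have hint : ∀ c : ℝ, 0 < c → IntegrableOn (fun t : ℝ => t ^ ((m : ℝ) + 1 - 1) * Real.exp (-t))
      (Ioi c) := fun c hc => by
    have := (Real.GammaIntegral_convergent (s := m + 1) (by positivity)).mono_set
      (Ioi_subset_Ioi hc.le)
    simpa only [mul_comm] using this
  rw [upperGamma, upperGamma,
    intervalIntegral.integral_Ioi_sub_Ioi (hint a ha) hab.le]
  refine intervalIntegral.intervalIntegral_pos_of_pos_on ?_ (fun t ht => ?_) hab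
  · exact (intervalIntegrable_iff_integrableOn_Ioc_of_le hab.le).2
      ((hint a ha).mono_set Ioc_subset_Ioi_self)
  · have : 0 < t := ha.trans ht.1
    positivity

section Coefficients

variable {m n₀ : ℕ} {f : ℍ → ℂ} {cp : ℤ → ℂ} {cm : ℕ+ → ℂ}

lemma expansion_comp_ofComplex (h : HasFourierExpansion (-(m : ℝ)) n₀ f cp cm) {z : ℂ}
    (hz : 0 < z.im) :
    (f ∘ ofComplex) z = (∑' n : Set.Ici (-(n₀ : ℤ)), cp n * expPow n z)
      + ∑' n : ℕ+, cm n * ((upperGamma (1 - -(m : ℝ)) (4 * Real.pi * (n : ℝ) * z.im) : ℝ) : ℂ)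
        * expPow (-((n : ℕ) : ℤ)) z := by
  rw [Function.comp_apply, ofComplex_apply_of_im_pos hz]
  exact (h ⟨z, hz⟩).2.2

/-- The first sum is c⁺(-n), or 0 when n > n₀. It does not depend on y, so it cancels between two
heights. -/
lemma integral_mul_expPow (h : HasFourierExpansion (-(m : ℝ)) n₀ f cp cm) (n : ℕ+) {y : ℝ}
    (hy : 0 < y) :
    ∫ x : ℝ in (0 : ℝ)..1, (f ∘ ofComplex) (x + y * Complex.I) * expPow n (x + y * Complex.I)
      = (∑' j : Set.Ici (-(n₀ : ℤ)), cp j * (if (j : ℤ) + (n : ℕ) = 0 then 1 else 0))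
        + cm n * ((upperGamma (1 - -(m : ℝ)) (4 * Real.pi * (n : ℝ) * y) : ℝ) : ℂ) := by
  have hy' : 0 < ((y : ℂ) * Complex.I).im := by simpa using hy
  obtain ⟨s1, s2, -⟩ := h ⟨(y : ℂ) * Complex.I, hy'⟩
  have him : ∀ x : ℝ, ((x : ℂ) + y * Complex.I).im = y := fun x => by simp
  have him0 : (⟨(y : ℂ) * Complex.I, hy'⟩ : ℍ).im = y := by
    change ((y : ℂ) * Complex.I).im = y
    simp
  rw [him0] at s2
  obtain ⟨c1, e1⟩ := integral_tsum_expPow (fun j : Set.Ici (-(n₀ : ℤ)) => cp j) (fun j => j)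
    ((n : ℕ) : ℤ) y s1
  obtain ⟨c2, e2⟩ := integral_tsum_expPow (fun j : ℕ+ =>
    cm j * ((upperGamma (1 - -(m : ℝ)) (4 * Real.pi * (j : ℝ) * y) : ℝ) : ℂ))
    (fun j => -((j : ℕ) : ℤ)) ((n : ℕ) : ℤ) y s2
  have e : ∀ x : ℝ, (f ∘ ofComplex) (x + y * Complex.I) * expPow n (x + y * Complex.I)
      = (∑' j : Set.Ici (-(n₀ : ℤ)), cp j * expPow j (x + y * Complex.I)) *
        expPow n (x + y * Complex.I) + (∑' j : ℕ+, cm j *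
        ((upperGamma (1 - -(m : ℝ)) (4 * Real.pi * (j : ℝ) * y) : ℝ) : ℂ)
        * expPow (-((j : ℕ) : ℤ)) (x + y * Complex.I)) * expPow n (x + y * Complex.I) := by
    intro x
    rw [expansion_comp_ofComplex h (by rw [him]; exact hy), him, add_mul]
  simp_rw [e]
  rw [intervalIntegral.integral_add (c1.intervalIntegrable _ _) (c2.intervalIntegrable _ _), e1, e2]
  congr 1
  rw [tsum_eq_single n fun j hj => ?_]
  · simp
  · have : ¬ (-((j : ℕ) : ℤ) + ((n : ℕ) : ℤ) = 0) := fun hcon => hj (PNat.eq (by omega))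
    rw [if_neg this, mul_zero]

/-- Green's theorem for F q^n on [0,1] × [1/n, 2/n]: the vertical sides cancel by periodicity, the
horizontal ones leave c⁻(n) times a constant, and the area integral is bounded by the invariant
norm. -/
theorem exists_coeff_bound {K : ℝ} (h : HasFourierExpansion (-(m : ℝ)) n₀ f cp cm)
    (hF : ContDiffOn ℝ 1 (f ∘ ofComplex) {z : ℂ | 0 < z.im})
    (hK : ∀ z : ℂ, 0 < z.im → xiNorm m (f ∘ ofComplex) z ≤ K) :
    ∃ K', ∀ n, ‖cm n‖ ≤ K' := by
  have hU : IsOpen {z : ℂ | 0 < z.im} := isOpen_lt continuous_const Complex.continuous_im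
  -- At the heights 1/n and 2/n the argument 4πny is 4π and 8π, so c is independent of n.
  set c : ℝ := upperGamma (1 - -(m : ℝ)) (4 * Real.pi) - upperGamma (1 - -(m : ℝ)) (8 * Real.pi)
    with hc
  have hc0 : 0 < c := by
    rw [hc, show 1 - -(m : ℝ) = m + 1 by ring]
    exact upperGamma_sub_pos m (by positivity) (by linarith [Real.pi_pos])
  have hK0 : 0 ≤ K := by
    refine le_trans ?_ (hK Complex.I (by simp))
    unfold xiNorm; simp
  refine ⟨K * √2 ^ m / c, fun n => ?_⟩
  have hn : (0 : ℝ) < n := Nat.cast_pos.2 n.pos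
  have hn1 : (1 : ℝ) ≤ n := Nat.one_le_cast.2 n.pos
  set F := f ∘ ofComplex with hFdef
  set V : ℂ → ℂ := fun z => F z * expPow n z with hV
  have hq : ContDiff ℝ 1 (expPow n) := by
    have : ContDiff ℂ 1 (expPow n) := by unfold expPow; fun_prop
    exact this.restrict_scalars ℝ
  have hVs : ContDiffOn ℝ 1 V {z : ℂ | 0 < z.im} := hF.mul hq.contDiffOn
  have hle : 1 / (n : ℝ) ≤ 2 / n := by gcongr; norm_num
  have hgreen := integral_rect_eq_dbar V 0 1 (1 / n) (2 / n) hU hVs (by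
    intro z hz
    have h1 := hz.2
    rw [mem_preimage, uIcc_of_le hle] at h1
    exact lt_of_lt_of_le (by positivity) h1.1)
  have hper : ∀ y ∈ uIcc (1 / (n : ℝ)) (2 / n),
      V (((1 : ℝ) : ℂ) + y * Complex.I) = V (((0 : ℝ) : ℂ) + y * Complex.I) := by
    intro y hy
    rw [uIcc_of_le hle] at hy
    have hy0 : 0 < y := lt_of_lt_of_le (by positivity) hy.1
    simp only [hV, hFdef]
    rw [expansion_comp_ofComplex h (by simpa using hy0),
      expansion_comp_ofComplex h (by simpa using hy0)]
    simp [expPow_add_one]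
  rw [intervalIntegral.integral_congr hper, add_sub_cancel_right] at hgreen
  have h1 := integral_mul_expPow h n (y := 1 / n) (by positivity)
  have h2 := integral_mul_expPow h n (y := 2 / n) (by positivity)
  rw [show 4 * Real.pi * (n : ℝ) * (1 / n) = 4 * Real.pi by field_simp] at h1
  rw [show 4 * Real.pi * (n : ℝ) * (2 / n) = 8 * Real.pi by field_simp; ring] at h2
  simp only [hV] at hgreen
  rw [h1, h2, add_sub_add_left_eq_sub, ← mul_sub, ← Complex.ofReal_sub, ← hc] at hgreen
  have hnorm : ‖cm n‖ * c ≤ K * √2 ^ m := by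
    rw [← Real.norm_of_nonneg hc0.le, ← Complex.norm_real c, ← norm_mul, hgreen]
    have hin : ∀ x : ℝ, ‖∫ y : ℝ in (1 / (n : ℝ))..(2 / n), Complex.I * dbar V (x + y * Complex.I)‖
        ≤ K * √2 ^ m := by
      intro x
      -- Since yn ≥ 1 on the rectangle, |`dbar F`| ≤ n · y|`dbar F`| ≤ nK y^{m/2} with y ≤ 2; the
      -- factor n is undone by the height 1/n of the rectangle.
      have hb : ∀ y ∈ uIoc (1 / (n : ℝ)) (2 / n),
          ‖Complex.I * dbar V (x + y * Complex.I)‖ ≤ K * √2 ^ m * n := by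
        intro y hy
        rw [uIoc_of_le hle] at hy
        have hy0 : 0 < y := lt_of_le_of_lt (by positivity) hy.1
        set z : ℂ := x + y * Complex.I with hz
        have hzim : z.im = y := by simp [hz]
        have hz0 : 0 < z.im := by rw [hzim]; exact hy0
        have hy2 : y ≤ 2 := hy.2.trans (div_le_self (by norm_num) hn1)
        have hyn : 1 ≤ y * n := by
          have := hy.1.le
          rwa [div_le_iff₀ hn] at this
        have hdV : dbar V z = dbar F z * expPow n z := by
          rw [hV, dbar_mul ((hF.differentiableOn one_ne_zero _ hz0).differentiableAt
            (hU.mem_nhds hz0)) (hq.differentiable one_ne_zero z),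
            dbar_eq_zero (differentiable_expPow _ z), mul_zero, add_zero]
        have hq1 : ‖expPow n z‖ ≤ 1 := by
          rw [norm_expPow, Real.exp_le_one_iff, hzim]
          have : 0 ≤ 2 * Real.pi * (((n : ℕ) : ℤ) : ℝ) * y := by positivity
          linarith
        have hKz := hK z hz0
        rw [xiNorm, hzim, div_mul_eq_mul_div, div_le_iff₀ (by positivity)] at hKz
        rw [norm_mul, Complex.norm_I, one_mul, hdV, norm_mul]
        have hsq : √y ^ m ≤ √2 ^ m := by gcongr
        have hD0 := norm_nonneg (dbar F z)
        calc ‖dbar F z‖ * ‖expPow n z‖ ≤ ‖dbar F z‖ * 1 := by gcongr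
          _ ≤ ‖dbar F z‖ * (y * n) := by gcongr
          _ = y * ‖dbar F z‖ * n := by ring
          _ ≤ K * √2 ^ m * n := by
            refine mul_le_mul_of_nonneg_right (hKz.trans ?_) hn.le
            gcongr
      refine (intervalIntegral.norm_integral_le_of_norm_le_const hb).trans_eq ?_
      rw [show (2 : ℝ) / n - 1 / n = 1 / n by ring, abs_of_pos (by positivity)]
      field_simp
    have := intervalIntegral.norm_integral_le_of_norm_le_const (a := (0 : ℝ)) (b := 1)
      (fun x _ => hin x)
    simpa using this
  rwa [le_div_iff₀ hc0]

end Coefficients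

end

/-! ### Assembly of the two cases. -/

theorem mainTheorem1 (N : ℕ) [NeZero N] (χ : DirichletCharacter ℂ N) (n₀ : ℕ)
    (cp dp : ℤ → ℂ) (Cf C : ℝ)
    (hcp : (fun n : ℕ => cp n) =O[atTop] (fun n : ℕ => Real.exp (Cf * √(n : ℝ))))
    (hdp : (fun n : ℕ => dp n) =O[atTop] (fun n : ℕ => Real.exp (Cf * √(n : ℝ))))
    (hC : max (Cf ^ 2 * √(N : ℝ) / (8 * Real.pi)) (2 * Real.pi * n₀ / √(N : ℝ)) < C) :
    (∀ (k : ℤ), k ≤ 0 → ∀ (f : ℍ → ℂ), IsHarmonicMaassForm k N χ f →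
      ∀ (cm dm : ℕ+ → ℂ), HasFourierExpansion k n₀ f cp cm →
      HasFourierExpansion k n₀ (frickeSlash k N f) dp dm →
      ∀ X : ℝ, 0 < X →
        Summable (fun n : Set.Ici (-(n₀ : ℤ)) => termCp C N X cp n) ∧
        (∀ l ∈ Finset.range (k.natAbs + 1), Summable (termCm C N X cm l)) ∧
        Summable (fun n : Set.Ici (-(n₀ : ℤ)) => termDp k C N X dp n) ∧
        (∀ l ∈ Finset.range (k.natAbs + 1), Summable (termDm k C N X dm l)) ∧
        (∑' n : Set.Ici (-(n₀ : ℤ)), termCp C N X cp n)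
          + ∑ l ∈ Finset.range (k.natAbs + 1),
              (((k.natAbs.factorial : ℝ) / (l.factorial : ℝ)
                * (4 * Real.pi * √C / √(N : ℝ) * √(1 + √(N : ℝ) * X / C)) ^ l : ℝ) : ℂ)
              * ∑' n : ℕ+, termCm C N X cm l n
        = Complex.I ^ k * ((C ^ ((k : ℝ) / 2) : ℝ) : ℂ)
            * ∑' n : Set.Ici (-(n₀ : ℤ)), termDp k C N X dp n
          + Complex.I ^ k * ((C ^ ((k : ℝ) / 2) : ℝ) : ℂ)
            * ∑ l ∈ Finset.range (k.natAbs + 1),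
              (((k.natAbs.factorial : ℝ) / (l.factorial : ℝ)
                * (4 * Real.pi * √C / √(N : ℝ)) ^ l : ℝ) : ℂ)
              * ∑' n : ℕ+, termDm k C N X dm l n) ∧
    (∀ (k : ℝ), (∃ m : ℤ, k = (m : ℝ) / 2) → ((¬ ∃ j : ℤ, k = j) → 4 ∣ N) →
      ∀ (f : ℍ → ℂ), IsWeaklyHolomorphicForm k N χ f →
      HasFourierExpansion k n₀ f cp 0 →
      HasFourierExpansion k n₀ (frickeSlash k N f) dp 0 →
      ∀ X : ℝ, 0 < X →
        Summable (fun n : Set.Ici (-(n₀ : ℤ)) => termCp C N X cp n) ∧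
        Summable (fun n : Set.Ici (-(n₀ : ℤ)) => termDp k C N X dp n) ∧
        (∑' n : Set.Ici (-(n₀ : ℤ)), termCp C N X cp n)
        = Complex.I ^ (k : ℂ) * ((C ^ (k / 2) : ℝ) : ℂ)
            * ∑' n : Set.Ici (-(n₀ : ℤ)), termDp k C N X dp n) := by
  refine ⟨?_, ?_⟩
  · intro k hk f hf cm dm hfe hge X hX
    obtain ⟨m, rfl⟩ := Int.exists_eq_neg_ofNat hk
    have hkR : (((-(m : ℤ) : ℤ)) : ℝ) = -(m : ℝ) := by push_cast; rfl
    -- Part (i) states i^k as an integer power, while the Fricke relation produces the principal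
    -- complex power.
    have hI : Complex.I ^ (-(m : ℤ)) = Complex.I ^ ((-(m : ℝ) : ℝ) : ℂ) := by
      rw [← Complex.cpow_intCast]; push_cast; rfl
    rw [hkR] at hf hfe hge
    rw [hkR, hI, Int.natAbs_neg, Int.natAbs_natCast]
    obtain ⟨K, hK⟩ := exists_xiNorm_bound hf
    have hF1 : ContDiffOn ℝ 1 (f ∘ ofComplex) {z : ℂ | 0 < z.im} := hf.smooth.of_le (by norm_cast)
    obtain ⟨K₁, hK₁⟩ := exists_coeff_bound hfe hF1 hK
    obtain ⟨hG1, hGK⟩ := fricke_contDiffOn_and_xiNorm (N := N) hF1 hK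
    obtain ⟨K₂, hK₂⟩ := exists_coeff_bound hge hG1 hGK
    exact harmonicMaass_identity m hcp hdp hK₁ hK₂ hC hfe hge hX
  · intro k _ _ f _ hfe hge X hX
    exact weaklyHolomorphic_identity k hcp hdp hC hfe hge hX
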